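/- Equip $\mathbb{C}^2$, with coordinates $(z,w)$, with its Euclidean norm. Let $\Omega\subset\mathbb{C}^2$ be a domain with $C^\infty$ boundary which is Hartogs, i.e. $(e^{i\theta}z,w)\in\Omega$ whenever $(z,w)\in\Omega$ and $\theta\in\mathbb{R}$. Let $\tilde\delta$ denote the signed distance function to the boundary $b\Omega$, so that $\tilde\delta(x)=-\operatorname{dist}(x,b\Omega)$ for $x\in\Omega$ and $\tilde\delta(x)=\operatorname{dist}(x,b\Omega)$ for $x\notin\Omega$. Suppose that for some fixed $w_0\in\mathbb{C}$, some $B>A>0$ and some $C>0$ the annulus $$M=\{(z,w_0): A\le |z|^2\le B\}$$ is contained in $b\Omega$, and that $$\left|\frac{\partial^2\tilde\delta}{\partial w\,\partial\bar z}(z,w_0)\right|>\frac{C}{|z|}\quad\text{for every }(z,w_0)\in M.$$ Then the Diederich–Fornæss index of $\Omega$ is at most $$\frac{\pi}{2C\log\frac{B}{A}+\pi}.$$ Here a number $\tau\in(0,1)$ is a Diederich–Fornæss exponent for $\Omega$ if there is a $C^\infty$ defining function $\rho$ for $\Omega$ (that is, $\Omega=\{\rho<0\}$ and $d\rho\ne0$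 on $b\Omega$) such that $-(-\rho)^\tau$ is plurisubharmonic on $\Omega$, and the Diederich–Fornæss index of $\Omega$ is the supremum of all Diederich–Fornæss exponents for $\Omega$ (equal to $0$ if there are none). -/

import Mathlib

open scoped ContDiff

noncomputable section

namespace DFIndex

/-- `ℂⁿ` with its Euclidean norm. -/
abbrev Cn (n : ℕ) : Type := EuclideanSpace ℂ (Fin n)

/-- The Wirtinger derivative `∂f/∂z_j = (∂f/∂x_j - i ∂f/∂y_j) / 2`, where `z_j = x_j + i y_j`. -/
def dz {n : ℕ} (j : Fin n) (f : Cn n → ℂ) (p : Cn n) : ℂ :=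
  (fderiv ℝ f p (EuclideanSpace.single j 1)
    - Complex.I * fderiv ℝ f p (EuclideanSpace.single j Complex.I)) / 2

/-- The Wirtinger derivative `∂f/∂z̄_j = (∂f/∂x_j + i ∂f/∂y_j) / 2`, where `z_j = x_j + i y_j`. -/
def dzbar {n : ℕ} (j : Fin n) (f : Cn n → ℂ) (p : Cn n) : ℂ :=
  (fderiv ℝ f p (EuclideanSpace.single j 1)
    + Complex.I * fderiv ℝ f p (EuclideanSpace.single j Complex.I)) / 2

/-- The mixed second derivative `∂²φ/∂z_j ∂z̄_k` of a real-valued function. -/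
def mixedDeriv {n : ℕ} (j k : Fin n) (φ : Cn n → ℝ) (p : Cn n) : ℂ :=
  dz j (dzbar k (fun x => (φ x : ℂ))) p

/-- A `C²` function is plurisubharmonic on the open set `Ω` if its complex Hessian is positive
semidefinite there. (The Hermitian form below is real-valued for `C²` functions, so taking the
real part only serves to make the inequality one between real numbers.) -/
def IsPlurisubharmonicOn {n : ℕ} (φ : Cn n → ℝ) (Ω : Set (Cn n)) : Prop :=
  ContDiffOn ℝ 2 φ Ω ∧
    ∀ p ∈ Ω, ∀ t : Fin n → ℂ,
      0 ≤ (∑ j, ∑ k, mixedDeriv j k φ p * t j * (starRingEnd ℂ) (t k)).re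

/-- `Ω` is a domain: open, connected and nonempty. -/
def IsDomainSet {n : ℕ} (Ω : Set (Cn n)) : Prop :=
  IsOpen Ω ∧ IsConnected Ω

/-- `Ω` has smooth boundary: near each of its boundary points, `Ω` is the sublevel set `{r < 0}`
of a smooth function `r` whose differential does not vanish at that point. -/
def HasSmoothBoundary {n : ℕ} (Ω : Set (Cn n)) : Prop :=
  ∀ p ∈ frontier Ω, ∃ (U : Set (Cn n)) (r : Cn n → ℝ), IsOpen U ∧ p ∈ U ∧ ContDiffOn ℝ ∞ r U ∧
    fderiv ℝ r p ≠ 0 ∧ Ω ∩ U = {x | r x < 0} ∩ U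

/-- `Ω ⊆ ℂ²` is Hartogs: it is invariant under the rotations `(z, w) ↦ (e^{iθ} z, w)`. -/
def IsHartogs (Ω : Set (Cn 2)) : Prop :=
  ∀ (z w : ℂ) (θ : ℝ), !₂[z, w] ∈ Ω → !₂[Complex.exp (θ * Complex.I) * z, w] ∈ Ω

open Classical in
/-- The signed distance to the boundary of `Ω`, negative in `Ω` and nonnegative outside. -/
def signedDist {n : ℕ} (Ω : Set (Cn n)) (x : Cn n) : ℝ :=
  if x ∈ Ω then -Metric.infDist x (frontier Ω) else Metric.infDist x (frontier Ω)

/-- `ρ` is a smooth defining function for `Ω`. -/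
def IsSmoothDefiningFunction {n : ℕ} (ρ : Cn n → ℝ) (Ω : Set (Cn n)) : Prop :=
  ContDiff ℝ ∞ ρ ∧ Ω = {x | ρ x < 0} ∧ ∀ p ∈ frontier Ω, fderiv ℝ ρ p ≠ 0

/-- `τ` is a Diederich–Fornæss exponent for `Ω`: `0 < τ < 1` and there is a smooth defining
function `ρ` for `Ω` such that `-(-ρ)^τ` is plurisubharmonic on `Ω`. -/
def IsDFExponent {n : ℕ} (Ω : Set (Cn n)) (τ : ℝ) : Prop :=
  0 < τ ∧ τ < 1 ∧ ∃ ρ : Cn n → ℝ, IsSmoothDefiningFunction ρ Ω ∧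
    IsPlurisubharmonicOn (fun x => -(-ρ x) ^ τ) Ω

/-- The Diederich–Fornæss index of `Ω`: the supremum of its Diederich–Fornæss exponents
(a subset of the interval `(0, 1)`; the supremum is `0` if there are none). -/
def dfIndex {n : ℕ} (Ω : Set (Cn n)) : ℝ :=
  sSup {τ : ℝ | IsDFExponent Ω τ}

/-- The closed annulus `{(z, w) : A ≤ |z|² ≤ B}` in the complex line where `w` is fixed. -/
def annulus (A B : ℝ) (w : ℂ) : Set (Cn 2) :=
  {p | p 1 = w ∧ A ≤ ‖p 0‖ ^ 2 ∧ ‖p 0‖ ^ 2 ≤ B}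

end DFIndex

end

open Filter Topology

/-! Let `f` be the `w`-coefficient of `dρ` along the annulus; it is twice `∂ρ/∂w`. It never vanishes
over the open annulus, because `dρ` kills the `z`-direction there. Put `x = log |z|`, `a = f_x / f`,
`κ = τ / (1 - τ)`. Two facts compete.

Geometry: the gradient of the distance at an exterior point is the normalized `dρ` at the nearest
boundary point. Where `f` is stationary along the circle, this gives `4 |z| |∂²δ̃/∂w∂z̄| ≤ |Im a|`
(`norm_mixedDeriv_signedDist_mul_le`), so the curvature hypothesis forces `|Im a| > 4C`. No
regularity of `δ̃` is needed: where a derivative does not exist, its default value `0` satisfies the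
bound.

Pseudoconvexity: the Levi form of `ρ` vanishes along the annulus. Plurisubharmonicity of `-(-ρ)^τ`,
expanded to second order at a boundary point (`levi_limit`), therefore becomes an inequality between
`f_xx`, `f_yy` and `a`, where `y = arg z`. If `τ` exceeded the bound, then with `η = 4Cκ` an
interval of length `π/η` would fit inside the range of `log |z|`. Maximize `sin (η (log |z| - x₀)) /
|f|^κ` over the corresponding subannulus. The sine vanishes on its edges, so the maximum is
interior. On its circle `|f|` is then minimal, and the Hartogs symmetry confines `f` to a real line,
so `f_y = 0` and `Re (f_yy / f) ≥ 0`. The radial second-order condition bounds `Re (f_xx / f)` from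
below. Together they give `|Im a| ≤ η/κ = 4C` (`mul_norm_mixedDeriv_le_of_max`), a contradiction. -/

namespace DFIndex

/-! ### Wirtinger derivatives in terms of real derivatives -/

/-- The coefficient `c` of a real-linear functional `L` in the `j`-th complex direction:
`L (single j u) = Re (c * u)`. -/
noncomputable def coeff {n : ℕ} (j : Fin n) : (Cn n →L[ℝ] ℝ) →L[ℝ] ℂ :=
  Complex.ofRealCLM.comp (ContinuousLinearMap.apply ℝ ℝ (EuclideanSpace.single j 1))
    - Complex.I • Complex.ofRealCLM.comp
      (ContinuousLinearMap.apply ℝ ℝ (EuclideanSpace.single j Complex.I))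

lemma coeff_apply {n : ℕ} (j : Fin n) (L : Cn n →L[ℝ] ℝ) :
    coeff j L = L (EuclideanSpace.single j 1) - Complex.I * L (EuclideanSpace.single j Complex.I) := by
  simp [coeff]

lemma single_eq_smul {n : ℕ} (j : Fin n) (u : ℂ) :
    (EuclideanSpace.single j u : Cn n) = u.re • EuclideanSpace.single j 1
      + u.im • EuclideanSpace.single j Complex.I := by
  ext k
  by_cases h : k = j
  · subst h
    simp [Complex.re_add_im]
  · simp [h]

lemma apply_single {n : ℕ} (j : Fin n) (L : Cn n →L[ℝ] ℝ) (u : ℂ) :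
    L (EuclideanSpace.single j u) = (coeff j L * u).re := by
  rw [single_eq_smul, coeff_apply]
  simp
  ring

lemma I_smul_single {n : ℕ} (j : Fin n) (u : ℂ) :
    Complex.I • (EuclideanSpace.single j u : Cn n) = EuclideanSpace.single j (Complex.I * u) := by
  ext k
  by_cases h : k = j
  · subst h; simp
  · simp [h]

lemma eq_single_add_single (v : Cn 2) :
    v = EuclideanSpace.single 0 (v 0) + EuclideanSpace.single 1 (v 1) := by
  ext k
  fin_cases k <;> simp

lemma dzbar_ofReal {n : ℕ} (k : Fin n) {φ : Cn n → ℝ} {L : Cn n →L[ℝ] ℝ} {x : Cn n}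
    (h : HasFDerivAt φ L x) :
    dzbar k (fun x => (φ x : ℂ)) x
      = (L (EuclideanSpace.single k 1) + Complex.I * L (EuclideanSpace.single k Complex.I)) / 2 := by
  have h' : HasFDerivAt (fun x => (φ x : ℂ)) (Complex.ofRealCLM.comp L) x :=
    Complex.ofRealCLM.hasFDerivAt.comp x h
  simp [dzbar, h'.fderiv]

lemma mixedDeriv_eq {n : ℕ} {φ : Cn n → ℝ} {A : Cn n → Cn n →L[ℝ] ℝ}
    {A' : Cn n →L[ℝ] Cn n →L[ℝ] ℝ} {p : Cn n} (h : ∀ᶠ x in 𝓝 p, HasFDerivAt φ (A x) x)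
    (hA : HasFDerivAt A A' p) (j k : Fin n) :
    mixedDeriv j k φ p =
      ((A' (EuclideanSpace.single j 1) (EuclideanSpace.single k 1)
        + A' (EuclideanSpace.single j Complex.I) (EuclideanSpace.single k Complex.I) : ℝ)
      + Complex.I * (A' (EuclideanSpace.single j 1) (EuclideanSpace.single k Complex.I)
        - A' (EuclideanSpace.single j Complex.I) (EuclideanSpace.single k 1) : ℝ)) / 4 := by
  set B : (Cn n →L[ℝ] ℝ) →L[ℝ] ℂ := (1 / 2 : ℂ) •
    (Complex.ofRealCLM.comp (ContinuousLinearMap.apply ℝ ℝ (EuclideanSpace.single k 1))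
    + Complex.I • Complex.ofRealCLM.comp
      (ContinuousLinearMap.apply ℝ ℝ (EuclideanSpace.single k Complex.I))) with hB
  have h1 : HasFDerivAt (fun x => B (A x)) (B.comp A') p := B.hasFDerivAt.comp p hA
  have h2 : dzbar k (fun x => (φ x : ℂ)) =ᶠ[𝓝 p] fun x => B (A x) := by
    filter_upwards [h] with x hx
    rw [dzbar_ofReal k hx, hB]
    simp
    ring
  rw [mixedDeriv, dz, (h1.congr_of_eventuallyEq h2).fderiv]
  simp [hB]
  ring_nf
  simp
  ring

/-- A real quadratic form is a Hermitian form plus the real part of a complex quadratic form; the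
latter changes sign under `v ↦ iv`, so summing over `v` and `iv` leaves the Levi form. Everything
later can use real derivatives only. -/
lemma re_levi_eq {φ : Cn 2 → ℝ} {A : Cn 2 → Cn 2 →L[ℝ] ℝ}
    {A' : Cn 2 →L[ℝ] Cn 2 →L[ℝ] ℝ} {p : Cn 2} (h : ∀ᶠ x in 𝓝 p, HasFDerivAt φ (A x) x)
    (hA : HasFDerivAt A A' p) (v : Cn 2) :
    (∑ j, ∑ k, mixedDeriv j k φ p * v j * (starRingEnd ℂ) (v k)).re
      = (A' v v + A' (Complex.I • v) (Complex.I • v)) / 4 := by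
  have key : ∀ a b c d : ℂ, A' (EuclideanSpace.single 0 a + EuclideanSpace.single 1 b)
      (EuclideanSpace.single 0 c + EuclideanSpace.single 1 d) =
      (a.re • A' (EuclideanSpace.single 0 1) + a.im • A' (EuclideanSpace.single 0 Complex.I)
       + (b.re • A' (EuclideanSpace.single 1 1) + b.im • A' (EuclideanSpace.single 1 Complex.I)))
      (c.re • EuclideanSpace.single 0 1 + c.im • EuclideanSpace.single 0 Complex.I
       + (d.re • EuclideanSpace.single 1 1 + d.im • EuclideanSpace.single 1 Complex.I)) := by
    intro a b c d
    rw [single_eq_smul 0 a, single_eq_smul 1 b, single_eq_smul 0 c, single_eq_smul 1 d]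
    simp only [map_add, map_smul]
  obtain ⟨a, b, rfl⟩ : ∃ a b : ℂ, v = EuclideanSpace.single 0 a + EuclideanSpace.single 1 b :=
    ⟨_, _, eq_single_add_single v⟩
  rw [smul_add, I_smul_single, I_smul_single, key, key]
  simp only [Fin.sum_univ_two, mixedDeriv_eq h hA]
  simp
  ring

/-! ### The Levi form inequality for a defining function -/

lemma hasFDerivAt_neg_neg_rpow {E : Type*} [NormedAddCommGroup E] [NormedSpace ℝ E] {ρ : E → ℝ}
    {L : E →L[ℝ] ℝ} {x : E} (τ : ℝ) (hρ : HasFDerivAt ρ L x) (hx : ρ x < 0) :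
    HasFDerivAt (fun x => -(-ρ x) ^ τ) ((τ * (-ρ x) ^ (τ - 1)) • L) x := by
  have h := ((hρ.neg).rpow_const (p := τ) (Or.inl (by simp; exact hx.ne))).neg
  refine h.congr_fderiv ?_
  ext v
  simp

/-- For a smooth defining function `ρ`, plurisubharmonicity of `-(-ρ)^τ` bounds the Levi form of
`ρ` from below. -/
lemma levi_nonneg_of_isPlurisubharmonicOn {ρ : Cn 2 → ℝ} (hρ : ContDiff ℝ ∞ ρ) {τ : ℝ}
    (hτ : 0 < τ) {Ω : Set (Cn 2)} (hΩ : Ω = {x | ρ x < 0})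
    (h : IsPlurisubharmonicOn (fun x => -(-ρ x) ^ τ) Ω) {q : Cn 2} (hq : ρ q < 0) (v : Cn 2) :
    0 ≤ (-ρ q) * (fderiv ℝ (fderiv ℝ ρ) q v v
        + fderiv ℝ (fderiv ℝ ρ) q (Complex.I • v) (Complex.I • v))
      + (1 - τ) * ((fderiv ℝ ρ q v) ^ 2 + (fderiv ℝ ρ q (Complex.I • v)) ^ 2) := by
  have hd : ∀ x, HasFDerivAt ρ (fderiv ℝ ρ x) x := fun x =>
    (hρ.differentiable (by simp) x).hasFDerivAt
  have hd2 : HasFDerivAt (fderiv ℝ ρ) (fderiv ℝ (fderiv ℝ ρ) q) q :=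
    (((hρ.fderiv_right (m := ∞) (by simp)).differentiable (by simp)) q).hasFDerivAt
  have h1 : ∀ᶠ x in 𝓝 q, HasFDerivAt (fun x => -(-ρ x) ^ τ)
      ((τ * (-ρ x) ^ (τ - 1)) • fderiv ℝ ρ x) x := by
    have : ∀ᶠ x in 𝓝 q, ρ x < 0 := hρ.continuous.continuousAt.eventually_lt_const hq
    filter_upwards [this] with x hx using hasFDerivAt_neg_neg_rpow τ (hd x) hx
  have h2 : HasFDerivAt (fun x => (τ * (-ρ x) ^ (τ - 1)) • fderiv ℝ ρ x) _ q :=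
    ((((hasFDerivAt_neg_neg_rpow (τ - 1) (hd q) hq).neg.congr_of_eventuallyEq
      (.of_forall fun x => (neg_neg _).symm)).const_mul τ).smul hd2)
  have h3 := h.2 q (by rw [hΩ]; exact hq) v
  have h4 := re_levi_eq (p := q) h1 h2 v
  rw [h4] at h3
  have hpos : 0 < -ρ q := by linarith
  have e1 : (-ρ q) ^ (τ - 1) = (-ρ q) ^ (τ - 1 - 1) * (-ρ q) := by
    rw [← Real.rpow_add_one hpos.ne']; congr 1; ring
  have hc : 0 < (-ρ q) ^ (τ - 1 - 1) := Real.rpow_pos_of_pos hpos _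
  simp at h3
  rw [e1] at h3
  -- The Hessian of `-(-ρ)^τ` is `τ (-ρ)^(τ-2)` times `(-ρ) D²ρ + (1-τ) dρ ⊗ dρ`; this positive
  -- factor is divided out.
  have hcc : 0 < τ * (-ρ q) ^ (τ - 1 - 1) / 4 := by positivity
  refine nonneg_of_mul_nonneg_right ?_ hcc
  exact h3.trans_eq (by ring)

/-! ### Third derivatives and the expansion at the boundary -/

section ThirdOrder

variable {E : Type*} [NormedAddCommGroup E] [NormedSpace ℝ E] {ρ : E → ℝ}

lemma hasFDerivAt_fderiv_of_contDiff {F : Type*} [NormedAddCommGroup F] [NormedSpace ℝ F]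
    {g : E → F} (hg : ContDiff ℝ ∞ g) (x : E) : HasFDerivAt g (fderiv ℝ g x) x :=
  (hg.differentiable (by simp) x).hasFDerivAt

lemma contDiff_fderiv_of_contDiff {F : Type*} [NormedAddCommGroup F] [NormedSpace ℝ F]
    {g : E → F} (hg : ContDiff ℝ ∞ g) : ContDiff ℝ ∞ (fderiv ℝ g) :=
  hg.fderiv_right (m := ∞) (by simp)

lemma fderiv_fderiv_symm {F : Type*} [NormedAddCommGroup F] [NormedSpace ℝ F]
    {g : E → F} (hg : ContDiff ℝ ∞ g) (x a b : E) :
    fderiv ℝ (fderiv ℝ g) x a b = fderiv ℝ (fderiv ℝ g) x b a :=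
  (hg.contDiffAt.isSymmSndFDerivAt (by simp; exact WithTop.coe_le_coe.2 (le_top : (2 : ℕ∞) ≤ ⊤))) a b

/-- Symmetry of the Hessian of `fderiv ℝ ρ` swaps the first two slots, and differentiating the
symmetry of `D²ρ` swaps the last two. It serves to move the normal direction into the last slot,
where `coeff 1` reads it. -/
lemma fderiv3_symm (hρ : ContDiff ℝ ∞ ρ) (x a b c : E) :
    fderiv ℝ (fderiv ℝ (fderiv ℝ ρ)) x a b c = fderiv ℝ (fderiv ℝ (fderiv ℝ ρ)) x b c a := by
  have h2 := contDiff_fderiv_of_contDiff (contDiff_fderiv_of_contDiff hρ)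
  have hb : ∀ y z : E, HasFDerivAt (fun x => fderiv ℝ (fderiv ℝ ρ) x y z)
      (((ContinuousLinearMap.apply ℝ ℝ z).comp (ContinuousLinearMap.apply ℝ (E →L[ℝ] ℝ) y)).comp
        (fderiv ℝ (fderiv ℝ (fderiv ℝ ρ)) x)) x := fun y z => by
    have hB := ((ContinuousLinearMap.apply ℝ ℝ z).comp
      (ContinuousLinearMap.apply ℝ (E →L[ℝ] ℝ) y)).hasFDerivAt (x := fderiv ℝ (fderiv ℝ ρ) x)
    exact hB.comp x (hasFDerivAt_fderiv_of_contDiff h2 x)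
  have h := (hb a c).unique ((hb c a).congr_of_eventuallyEq
    (.of_forall fun x => fderiv_fderiv_symm hρ x a c))
  rw [fderiv_fderiv_symm (contDiff_fderiv_of_contDiff hρ) x a b]
  simpa using DFunLike.congr_fun h b

lemma hasDerivAt_fderiv_comp {F : Type*} [NormedAddCommGroup F] [NormedSpace ℝ F]
    {g : E → F} (hg : ContDiff ℝ ∞ g) {c : ℝ → E} {c' : E} {t : ℝ} (hc : HasDerivAt c c' t) :
    HasDerivAt (fun t => g (c t)) (fderiv ℝ g (c t) c') t :=
  (hasFDerivAt_fderiv_of_contDiff hg (c t)).comp_hasDerivAt t hc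

end ThirdOrder

section Limit

variable {E : Type*} [NormedAddCommGroup E] [NormedSpace ℂ E]  {ρ : E → ℝ}

/-- Second-order expansion of the Levi form inequality at a boundary point `p`, along points
`p + ε U` and directions `Z + ε S`, where the Levi form vanishes in the direction `Z` at `p`. -/
lemma levi_limit (hρ : ContDiff ℝ ∞ ρ) {τ : ℝ}
    (H : ∀ q, ρ q < 0 → ∀ v, 0 ≤ (-ρ q) * (fderiv ℝ (fderiv ℝ ρ) q v v
        + fderiv ℝ (fderiv ℝ ρ) q (Complex.I • v) (Complex.I • v))
      + (1 - τ) * ((fderiv ℝ ρ q v) ^ 2 + (fderiv ℝ ρ q (Complex.I • v)) ^ 2))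
    {p Z U S : E} (h0 : ρ p = 0) (hZ : fderiv ℝ ρ p Z = 0) (hIZ : fderiv ℝ ρ p (Complex.I • Z) = 0)
    (hZZ : fderiv ℝ (fderiv ℝ ρ) p Z Z
      + fderiv ℝ (fderiv ℝ ρ) p (Complex.I • Z) (Complex.I • Z) = 0)
    (hU : fderiv ℝ ρ p U < 0) :
    0 ≤ (-fderiv ℝ ρ p U) * (fderiv ℝ (fderiv ℝ (fderiv ℝ ρ)) p U Z Z
        + fderiv ℝ (fderiv ℝ (fderiv ℝ ρ)) p U (Complex.I • Z) (Complex.I • Z)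
        + 2 * fderiv ℝ (fderiv ℝ ρ) p Z S
        + 2 * fderiv ℝ (fderiv ℝ ρ) p (Complex.I • Z) (Complex.I • S))
      + (1 - τ) * ((fderiv ℝ (fderiv ℝ ρ) p U Z + fderiv ℝ ρ p S) ^ 2
        + (fderiv ℝ (fderiv ℝ ρ) p U (Complex.I • Z) + fderiv ℝ ρ p (Complex.I • S)) ^ 2) := by
  have hD1 := contDiff_fderiv_of_contDiff hρ
  have hD2 := contDiff_fderiv_of_contDiff hD1
  have hq : HasDerivAt (fun ε : ℝ => p + ε • U) U 0 := by
    simpa using ((hasDerivAt_id (0 : ℝ)).smul_const U).const_add p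
  have hv : ∀ X Y : E, HasDerivAt (fun ε : ℝ => X + ε • Y) Y 0 := fun X Y => by
    simpa using ((hasDerivAt_id (0 : ℝ)).smul_const Y).const_add X
  have e0 := hasDerivAt_fderiv_comp hρ hq
  have e1 : ∀ X Y : E, HasDerivAt (fun ε : ℝ => fderiv ℝ ρ (p + ε • U) (X + ε • Y))
      (fderiv ℝ (fderiv ℝ ρ) p U X + fderiv ℝ ρ p Y) 0 := fun X Y => by
    simpa using (hasDerivAt_fderiv_comp hD1 hq).clm_apply (hv X Y)
  have e2 : ∀ X Y : E, HasDerivAt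
      (fun ε : ℝ => fderiv ℝ (fderiv ℝ ρ) (p + ε • U) (X + ε • Y) (X + ε • Y))
      (fderiv ℝ (fderiv ℝ (fderiv ℝ ρ)) p U X X + 2 * fderiv ℝ (fderiv ℝ ρ) p X Y) 0 :=
    fun X Y => by
    have := ((hasDerivAt_fderiv_comp hD2 hq).clm_apply (hv X Y)).clm_apply (hv X Y)
    refine this.congr_deriv ?_
    simp
    rw [fderiv_fderiv_symm hρ p Y X]
    ring
  -- `ρ`, the Levi form and both first derivatives vanish at `ε = 0`, so every term of the
  -- inequality is a product of two factors of order `ε`; the limit is taken after multiplying by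
  -- `ε⁻²`.
  have sl : ∀ {g : ℝ → ℝ} {g' : ℝ}, HasDerivAt g g' 0 → g 0 = 0 →
      Tendsto (fun ε => ε⁻¹ * g ε) (𝓝[>] 0) (𝓝 g') := fun {g g'} h hg => by
    have := h.tendsto_slope.mono_left (nhdsGT_le_nhdsNE (0 : ℝ))
    refine this.congr fun ε => ?_
    simp [slope, hg]
  have t0 := sl e0 (by simp [h0])
  have t1 := sl (e1 Z S) (by simp [hZ])
  have t2 := sl (e1 (Complex.I • Z) (Complex.I • S)) (by simp [hIZ])
  have t3 := sl ((e2 Z S).add (e2 (Complex.I • Z) (Complex.I • S))) (by simpa using hZZ)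
  have t4 := (t0.neg.mul t3).add (((t1.pow 2).add (t2.pow 2)).const_mul (1 - τ))
  simp only [zero_smul, add_zero] at t4
  have hneg : ∀ᶠ ε in 𝓝[>] (0 : ℝ), ρ (p + ε • U) < 0 := by
    have : fderiv ℝ ρ (p + (0 : ℝ) • U) U < 0 := by simpa using hU
    filter_upwards [t0.eventually_lt_const this, self_mem_nhdsWithin] with ε h1 h2
    have h2' : (0 : ℝ) < ε⁻¹ := inv_pos.mpr h2
    by_contra hc
    exact absurd h1 (not_lt.mpr (mul_nonneg h2'.le (not_lt.mp hc)))
  refine (ge_of_tendsto t4 ?_).trans_eq (by ring)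
  filter_upwards [hneg, self_mem_nhdsWithin] with ε h1 h2
  have h2' : (0 : ℝ) < ε⁻¹ := inv_pos.mpr h2
  have h3 := H _ h1 (Z + ε • S)
  have h4 : Complex.I • (Z + ε • S) = Complex.I • Z + ε • Complex.I • S := by
    rw [smul_add, smul_comm]
  rw [h4] at h3
  refine (mul_nonneg (sq_nonneg ε⁻¹) h3).trans_eq ?_
  simp only [Pi.add_apply]
  ring

end Limit

/-! ### Elementary tools: functionals, minima, boundary crossings -/

/-- A linear functional that is nonnegative wherever another one is positive is a nonnegative
multiple of it. -/
lemma exists_eq_smul_of_pos_imp_nonneg {E : Type*} [AddCommGroup E] [Module ℝ E] {a b : E →ₗ[ℝ] ℝ}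
    (ha : a ≠ 0) (h : ∀ v, 0 < a v → 0 ≤ b v) : ∃ μ : ℝ, 0 ≤ μ ∧ b = μ • a := by
  obtain ⟨n, hn⟩ : ∃ n, 0 < a n := by
    obtain ⟨v, hv⟩ := DFunLike.ne_iff.mp ha
    rcases lt_or_gt_of_ne hv with hv | hv
    · exact ⟨-v, by simpa using hv⟩
    · exact ⟨v, hv⟩
  have hker : ∀ v, a v = 0 → 0 ≤ b v := by
    intro v hv
    refine ge_of_tendsto (x := 𝓝[>] (0 : ℝ)) (f := fun ε : ℝ => b v + ε * b n) ?_ ?_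
    · have : Continuous fun ε : ℝ => b v + ε * b n := by fun_prop
      simpa using (this.tendsto 0).mono_left nhdsWithin_le_nhds
    · filter_upwards [self_mem_nhdsWithin] with ε hε
      have := h (v + ε • n) (by simpa [hv] using mul_pos hε hn)
      simpa using this
  have hker' : ∀ v, a v = 0 → b v = 0 := fun v hv =>
    le_antisymm (by simpa using hker (-v) (by simp [hv])) (hker v hv)
  refine ⟨b n / a n, div_nonneg (h n hn) hn.le, ?_⟩
  ext v
  have := hker' (v - (a v / a n) • n) (by simp [hn.ne'])
  simp at this
  simp
  field_simp at this ⊢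
  linarith

/-- The second derivative is nonnegative at a local minimum. -/
lemma nonneg_of_isLocalMin_of_hasDerivAt {g g' : ℝ → ℝ} {g'' x : ℝ}
    (h : IsLocalMin g x) (h1 : ∀ᶠ y in 𝓝 x, HasDerivAt g (g' y) y) (h2 : HasDerivAt g' g'' x) :
    g' x = 0 ∧ 0 ≤ g'' := by
  have hd : deriv g =ᶠ[𝓝 x] g' := h1.mono fun y hy => hy.deriv
  have h0 : g' x = 0 := h.hasDerivAt_eq_zero h1.self_of_nhds
  refine ⟨h0, ?_⟩
  by_contra! hneg
  have hdd : deriv (deriv g) x = g'' := by rw [hd.deriv_eq, h2.deriv]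
  -- With `g'' < 0` the point would also be a local maximum, hence `g` locally constant and `g'' =
  -- 0`.
  have hmax := isLocalMax_of_deriv_deriv_neg (f := g) (by rw [hdd]; exact hneg)
    (by rw [hd.self_of_nhds, h0]) h1.self_of_nhds.continuousAt
  have hconst : g =ᶠ[𝓝 x] fun _ => g x := by
    filter_upwards [h, hmax] with y a b using le_antisymm b a
  have : g' =ᶠ[𝓝 x] fun _ => 0 := by
    filter_upwards [hconst.eventuallyEq_nhds, hd] with y a b
    rw [← b, a.deriv_eq, deriv_const]
  have := h2.unique ((hasDerivAt_const x (0 : ℝ)).congr_of_eventuallyEq this)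
  exact hneg.ne this

lemma IsPreconnected.inter_frontier_nonempty {X : Type*} [TopologicalSpace X] {s u : Set X}
    (hs : IsPreconnected s) {x y : X} (hx : x ∈ s) (hxu : x ∈ u) (hy : y ∈ s) (hyu : y ∉ u) :
    (s ∩ frontier u).Nonempty := by
  by_contra h
  have hsub : s ⊆ interior u ∪ interior uᶜ := by
    rw [← compl_frontier_eq_union_interior]
    exact fun z hz hzf => h ⟨z, hz, hzf⟩
  have hd : Disjoint (interior u) (interior uᶜ) :=
    disjoint_compl_right.mono interior_subset interior_subset
  rcases hs.subset_or_subset isOpen_interior isOpen_interior hd hsub with h' | h'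
  · exact hyu (interior_subset (h' hy))
  · exact interior_subset (h' hx) hxu

lemma eq_zero_of_mem_frontier {X : Type*} [TopologicalSpace X] {ρ : X → ℝ} (hρ : Continuous ρ)
    {y : X} (hy : y ∈ frontier {x | ρ x < 0}) : ρ y = 0 :=
  frontier_lt_subset_eq hρ continuous_const hy

lemma exists_quadratic_remainder_bound {E : Type*} [NormedAddCommGroup E] [NormedSpace ℝ E] {ρ : E → ℝ}
    (hρ : ContDiff ℝ ∞ ρ) (p : E) :
    ∃ M > 0, ∃ r > 0, ∀ v, ‖v‖ < r → |ρ (p + v) - ρ p - fderiv ℝ ρ p v| ≤ M * ‖v‖ ^ 2 := by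
  obtain ⟨K, t, ht, hK⟩ := ((contDiff_fderiv_of_contDiff hρ).contDiffAt (x := p)).of_le
    (m := 1) (by simp) |>.exists_lipschitzOnWith
  obtain ⟨r, hr, hrt⟩ := Metric.mem_nhds_iff.mp ht
  refine ⟨K + 1, by positivity, r, hr, fun v hv => ?_⟩
  have hp : p ∈ Metric.closedBall p ‖v‖ := Metric.mem_closedBall_self (norm_nonneg v)
  have hsub : Metric.closedBall p ‖v‖ ⊆ t := (Metric.closedBall_subset_ball hv).trans hrt
  have h := Convex.norm_image_sub_le_of_norm_hasFDerivWithin_le' (𝕜 := ℝ) (f := ρ)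
    (f' := fderiv ℝ ρ) (φ := fderiv ℝ ρ p) (C := K * ‖v‖) (s := Metric.closedBall p ‖v‖)
    (x := p) (y := p + v)
    (fun x _ => (hasFDerivAt_fderiv_of_contDiff hρ x).hasFDerivWithinAt)
    (fun x hx => by
      refine (hK.norm_sub_le (hsub hx) (hsub hp)).trans ?_
      have : ‖x - p‖ ≤ ‖v‖ := by simpa [dist_eq_norm] using hx
      gcongr) (convex_closedBall _ _) hp (by simp)
  simp only [add_sub_cancel_left, Real.norm_eq_abs] at h
  nlinarith [sq_nonneg ‖v‖]

/-! ### Nearest boundary points of exterior points -/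

section Nearest

variable {E : Type*} [NormedAddCommGroup E] [InnerProductSpace ℝ E] {ρ : E → ℝ} {x y : E}

/-- At a nearest boundary point `y` to an exterior point `x`, the differential of the defining
function is a nonnegative multiple of the functional `⟪x - y, ·⟫`. -/
lemma fderiv_eq_smul_of_nearest (hρ : ContDiff ℝ ∞ ρ) (hx : 0 < ρ x)
    (hy : y ∈ frontier {x | ρ x < 0})
    (hxy : Metric.infDist x (frontier {x | ρ x < 0}) = dist x y) :
    x ≠ y ∧ ∃ μ : ℝ, 0 ≤ μ ∧ fderiv ℝ ρ y = μ • innerSL ℝ (x - y) := by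
  have hy0 := eq_zero_of_mem_frontier hρ.continuous hy
  have hne : x ≠ y := fun h => by rw [h, hy0] at hx; exact lt_irrefl _ hx
  refine ⟨hne, ?_⟩
  -- A point of the ball with `ρ < 0` would force a boundary point closer to `x` than `y`.
  have hball : ∀ z ∈ Metric.ball x (dist x y), 0 ≤ ρ z := by
    intro z hz
    by_contra! hneg
    obtain ⟨m, hm, hmf⟩ := IsPreconnected.inter_frontier_nonempty
      (convex_ball x (dist x y)).isPreconnected hz (u := {x | ρ x < 0}) hneg
      (Metric.mem_ball_self (dist_pos.mpr hne)) (by simpa using hx.le)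
    have := Metric.infDist_le_dist_of_mem (x := x) hmf
    rw [hxy, dist_comm x m] at this
    exact absurd (Metric.mem_ball.mp hm) (not_lt.mpr this)
  have hpos : ∀ v, 0 < inner ℝ (x - y) v → 0 ≤ fderiv ℝ ρ y v := by
    intro v hv
    have hc : HasDerivAt (fun s : ℝ => y + s • v) v 0 := by
      simpa using ((hasDerivAt_id (0 : ℝ)).smul_const v).const_add y
    have hd := (hasDerivAt_fderiv_comp hρ hc).tendsto_slope.mono_left (nhdsGT_le_nhdsNE (0 : ℝ))
    simp only [zero_smul, add_zero] at hd
    refine ge_of_tendsto hd ?_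
    have hsmall : ∀ᶠ s in 𝓝[>] (0 : ℝ), s * ‖v‖ ^ 2 < 2 * inner ℝ (x - y) v := by
      have : ContinuousAt (fun s : ℝ => s * ‖v‖ ^ 2) 0 := by fun_prop
      exact nhdsWithin_le_nhds (this.eventually_lt_const (by simpa using hv))
    filter_upwards [hsmall, self_mem_nhdsWithin] with s hs hs0
    have hs0' : 0 < s := hs0
    have hmem : y + s • v ∈ Metric.ball x (dist x y) := by
      rw [Metric.mem_ball, dist_comm, dist_eq_norm, dist_eq_norm]
      refine lt_of_pow_lt_pow_left₀ 2 (norm_nonneg _) ?_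
      have : x - (y + s • v) = (x - y) - s • v := by abel
      rw [this, norm_sub_sq_real, inner_smul_right, norm_smul, mul_pow, Real.norm_eq_abs, sq_abs]
      nlinarith
    have := hball _ hmem
    simp only [slope, vsub_eq_sub, sub_zero, zero_smul, add_zero, hy0, smul_eq_mul]
    positivity
  obtain ⟨μ, hμ, h⟩ := exists_eq_smul_of_pos_imp_nonneg (a := (innerSL ℝ (x - y)).toLinearMap)
    (b := (fderiv ℝ ρ y).toLinearMap) (fun h => inner_self_ne_zero.mpr (sub_ne_zero.mpr hne)
      (show inner ℝ (x - y) (x - y) = 0 from DFunLike.congr_fun h (x - y))) hpos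
  exact ⟨μ, hμ, by ext v; simpa using DFunLike.congr_fun h v⟩

/-- The gradient of the distance to a set at a point of differentiability points away from the
nearest point. -/
lemma fderiv_infDist_eq {s : Set E} (hy : y ∈ s) (hxy : Metric.infDist x s = dist x y)
    (hne : x ≠ y) (hd : DifferentiableAt ℝ (fun z => Metric.infDist z s) x) :
    fderiv ℝ (fun z => Metric.infDist z s) x = ‖x - y‖⁻¹ • innerSL ℝ (x - y) := by
  have hn : ‖x - y‖ ≠ 0 := by simpa [sub_eq_zero] using hne
  have h1 : HasFDerivAt (fun z => ‖z - y‖ ^ 2) (2 • innerSL ℝ (x - y)) x := by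
    simpa using ((hasFDerivAt_id (𝕜 := ℝ) x).sub_const y).norm_sq
  have h2 := hd.hasFDerivAt.pow 2
  -- The distance to `y` dominates the distance to `s`, with equality at `x`, so the two squares
  -- have the same derivative there.
  have hmin : IsLocalMin (fun z => ‖z - y‖ ^ 2 - Metric.infDist z s ^ 2) x := by
    refine Eventually.of_forall fun z => ?_
    have e1 : Metric.infDist z s ≤ ‖z - y‖ := by
      simpa [dist_eq_norm] using Metric.infDist_le_dist_of_mem (x := z) hy
    have e2 : Metric.infDist x s = ‖x - y‖ := by rw [hxy, dist_eq_norm]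
    have e3 := Metric.infDist_nonneg (x := z) (s := s)
    simp only [e2, sub_self]
    exact sub_nonneg.mpr (pow_le_pow_left₀ e3 e1 2)
  have h0 := hmin.hasFDerivAt_eq_zero (h1.sub h2)
  ext v
  have := DFunLike.congr_fun h0 v
  simp [hxy, dist_eq_norm] at this
  simp
  field_simp
  linarith

/-- A function bounded, at exterior points near the boundary, by a smooth quantity at the nearest
boundary point that vanishes at `p`, has at `p` vanishing normal derivative and tangential
derivatives controlled by those of that quantity. -/
lemma fderiv_bound_of_nearest [ProperSpace E] (hρ : ContDiff ℝ ∞ ρ) {p N T : E} {a : ℝ}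
    (hp : p ∈ frontier {x | ρ x < 0}) (ha : 0 < a)
    (hgrad : ∀ v, fderiv ℝ ρ p v = a * inner ℝ N v) (hN : ‖N‖ = 1) (hT : ‖T‖ = 1)
    (hNT : inner ℝ N T = 0) {F : Type*} [NormedAddCommGroup F] [NormedSpace ℝ F] {G k : E → F}
    {G' k' : E →L[ℝ] F} (hG : HasFDerivAt G G' p) (hk : HasFDerivAt k k' p) (hkp : k p = 0)
    (hGk : ∀ x y, 0 < ρ x → y ∈ frontier {x | ρ x < 0} →
      Metric.infDist x (frontier {x | ρ x < 0}) = dist x y → ‖G x‖ * ‖fderiv ℝ ρ y‖ ≤ ‖k y‖) :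
    G' N = 0 ∧ ‖G' T‖ * ‖fderiv ℝ ρ p‖ ≤ ‖k' T‖ := by
  have hp0 := eq_zero_of_mem_frontier hρ.continuous hp
  obtain ⟨M, hM, r, hr, hquad⟩ := exists_quadratic_remainder_bound hρ p
  simp only [hp0, sub_zero] at hquad
  have hinv : Tendsto (fun s : ℝ => s⁻¹ * s) (𝓝[>] 0) (𝓝 1) := by
    refine tendsto_const_nhds.congr' ?_
    filter_upwards [self_mem_nhdsWithin] with s hs
    exact (inv_mul_cancel₀ (ne_of_gt hs)).symm
  have hs0 : Tendsto (fun s : ℝ => s) (𝓝[>] 0) (𝓝 0) := nhdsWithin_le_nhds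
  have hDpos : 0 < ‖fderiv ℝ ρ p‖ := by
    rw [norm_pos_iff]
    intro h
    have := hgrad N
    rw [h, real_inner_self_eq_norm_sq, hN] at this
    simp at this
    exact ha.ne this
  have hnear := fun x => isClosed_frontier.exists_infDist_eq_dist ⟨p, hp⟩ x
    (s := frontier {x | ρ x < 0})
  -- For small `s` the nearest point `y` to `p + sN` is `p`: comparing distances gives `|y-p|² ≤
  -- 2s⟪N, y-p⟫`, while `ρ y = 0` gives `a⟪N, y-p⟫ ≤ M|y-p|²`; for `s < a/(2M)` these force `y = p`.
  have hGN : ∀ᶠ s in 𝓝[>] (0 : ℝ), G (p + s • N) = 0 := by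
    have c1 : ∀ᶠ s in 𝓝[>] (0 : ℝ), s < r / 2 := hs0.eventually_lt_const (by positivity)
    have c2 : ∀ᶠ s in 𝓝[>] (0 : ℝ), s < a / (2 * M) := hs0.eventually_lt_const (by positivity)
    filter_upwards [c1, c2, self_mem_nhdsWithin] with s h1 h2 h3
    have h3' : 0 < s := h3
    have hsN : ‖s • N‖ = s := by rw [norm_smul, hN, Real.norm_of_nonneg h3'.le, mul_one]
    rw [lt_div_iff₀ (by positivity)] at h2
    have hpos : 0 < ρ (p + s • N) := by
      have := (abs_le.mp (hquad (s • N) (by rw [hsN]; linarith))).1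
      rw [hsN, hgrad, inner_smul_right, real_inner_self_eq_norm_sq, hN] at this
      nlinarith
    obtain ⟨y, hy, hxy⟩ := hnear (p + s • N)
    have hy0 := eq_zero_of_mem_frontier hρ.continuous hy
    have hle : ‖s • N - (y - p)‖ ≤ s := by
      have := Metric.infDist_le_dist_of_mem (x := p + s • N) hp
      rw [hxy, dist_eq_norm, dist_eq_norm, add_sub_cancel_left, hsN] at this
      refine (le_of_eq ?_).trans this
      congr 1
      abel
    have hv : ‖y - p‖ ≤ 2 * s := by
      have := norm_sub_le (s • N) (s • N - (y - p))
      rw [sub_sub_cancel] at this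
      linarith
    have hsq : ‖y - p‖ ^ 2 ≤ 2 * s * inner ℝ N (y - p) := by
      have := pow_le_pow_left₀ (norm_nonneg _) hle 2
      rw [norm_sub_sq_real, hsN, real_inner_smul_left] at this
      linarith
    have hq := (abs_le.mp (hquad (y - p) (by linarith))).1
    rw [add_sub_cancel, hy0, hgrad] at hq
    have hyp : y = p := by
      by_contra hne
      have hvpos : 0 < ‖y - p‖ ^ 2 := by
        have := norm_pos_iff.mpr (sub_ne_zero.mpr hne)
        positivity
      have h5 : a * ‖y - p‖ ^ 2 ≤ 2 * s * M * ‖y - p‖ ^ 2 := by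
        nlinarith
      nlinarith
    have := hGk _ _ hpos hy hxy
    rw [hyp, hkp, norm_zero] at this
    have h6 : ‖G (p + s • N)‖ ≤ 0 := nonpos_of_mul_nonpos_left this hDpos
    simpa using h6
  have hlim : ∀ {d : ℝ → E} {v : E}, Tendsto d (𝓝[>] 0) (𝓝 0) →
      Tendsto (fun s => s⁻¹ • d s) (𝓝[>] 0) (𝓝 v) → ∀ {g : E → F} {g' : E →L[ℝ] F},
      HasFDerivAt g g' p → Tendsto (fun s => s⁻¹ • (g (p + d s) - g p)) (𝓝[>] 0) (𝓝 (g' v)) :=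
    fun hd hv _ _ hg => hg.hasFDerivWithinAt.lim hd (.of_forall fun _ => Set.mem_univ _) hv
  have dN0 : Tendsto (fun s : ℝ => s • N) (𝓝[>] 0) (𝓝 0) := by
    simpa using hs0.smul_const N
  have hGp : G p = 0 := by
    have h1 : Tendsto (fun s : ℝ => G (p + s • N)) (𝓝[>] 0) (𝓝 (G p)) := by
      refine hG.continuousAt.tendsto.comp ?_
      simpa using dN0.const_add p
    exact tendsto_nhds_unique h1
      (tendsto_const_nhds.congr' (hGN.mono fun s hs => hs.symm))
  refine ⟨?_, ?_⟩
  · have h1 := hlim dN0 (v := N) (by simpa [smul_smul] using hinv.smul_const N) hG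
    refine tendsto_nhds_unique h1 (tendsto_const_nhds.congr' (hGN.mono fun s hs => ?_))
    simp [hs, hGp]
  -- At `p + sT ± Ks²N` the linear part of `ρ` is `±(4M+1)s²` and the error at most `4Ms²`, so the
  -- signs are opposite and a boundary point lies within `2Ks²` of the exterior one. Its nearest
  -- point is thus `p + sT + O(s²)`, which has the same first-order behaviour as `p + sT`.
  set K : ℝ := (4 * M + 1) / a with hK
  have hKpos : 0 < K := by positivity
  have haK : a * K = 4 * M + 1 := by rw [hK]; field_simp
  have hpt : ∀ᶠ s in 𝓝[>] (0 : ℝ), ∃ d : E, ‖d - s • T‖ ≤ 3 * K * s ^ 2 ∧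
      ‖G (p + (s • T + (K * s ^ 2) • N))‖ * ‖fderiv ℝ ρ (p + d)‖ ≤ ‖k (p + d)‖ := by
    have c1 : ∀ᶠ s in 𝓝[>] (0 : ℝ), s < r / 2 := hs0.eventually_lt_const (by positivity)
    have c2 : ∀ᶠ s in 𝓝[>] (0 : ℝ), s < K⁻¹ := hs0.eventually_lt_const (by positivity)
    filter_upwards [c1, c2, self_mem_nhdsWithin] with s h1 h2 h3
    have h3' : 0 < s := h3
    have hKs : K * s ≤ 1 := by
      have := mul_lt_mul_of_pos_left h2 hKpos
      rw [mul_inv_cancel₀ hKpos.ne'] at this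
      exact this.le
    have hnorm : ∀ e : ℝ, |e| ≤ K * s ^ 2 → ‖s • T + e • N‖ ≤ 2 * s := by
      intro e he
      refine (norm_add_le _ _).trans ?_
      rw [norm_smul, norm_smul, hN, hT, Real.norm_of_nonneg h3'.le, Real.norm_eq_abs]
      nlinarith
    have hval : ∀ e : ℝ, |e| ≤ K * s ^ 2 → |ρ (p + (s • T + e • N)) - a * e| ≤ 4 * M * s ^ 2 := by
      intro e he
      have hn := hnorm e he
      have := hquad (s • T + e • N) (by linarith)
      rw [hgrad, inner_add_right, inner_smul_right, inner_smul_right, hNT,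
        real_inner_self_eq_norm_sq, hN] at this
      have hn2 := pow_le_pow_left₀ (norm_nonneg _) hn 2
      simp only [mul_zero, zero_add, one_pow, mul_one] at this
      nlinarith
    have hKs2 : 0 < K * s ^ 2 := by positivity
    have hpos : 0 < ρ (p + (s • T + (K * s ^ 2) • N)) := by
      have := (abs_le.mp (hval (K * s ^ 2) (by rw [abs_of_pos hKs2]))).1
      nlinarith [sq_pos_of_pos h3']
    have hneg : ρ (p + (s • T + (-(K * s ^ 2)) • N)) < 0 := by
      have := (abs_le.mp (hval (-(K * s ^ 2)) (by rw [abs_neg, abs_of_pos hKs2]))).2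
      nlinarith [sq_pos_of_pos h3']
    obtain ⟨m, hm, hmf⟩ := IsPreconnected.inter_frontier_nonempty
      (convex_closedBall (p + (s • T + (K * s ^ 2) • N)) (2 * (K * s ^ 2))).isPreconnected
      (u := {x | ρ x < 0}) (x := p + (s • T + (-(K * s ^ 2)) • N))
      (by
        rw [Metric.mem_closedBall, dist_eq_norm]
        have : p + (s • T + (-(K * s ^ 2)) • N) - (p + (s • T + (K * s ^ 2) • N))
          = (-(2 * (K * s ^ 2))) • N := by module
        rw [this, norm_smul, hN, norm_neg, Real.norm_of_nonneg (by positivity), mul_one])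
      hneg (Metric.mem_closedBall_self (by positivity)) (by simpa using hpos.le)
    obtain ⟨y, hy, hxy⟩ := hnear (p + (s • T + (K * s ^ 2) • N))
    refine ⟨y - p, ?_, ?_⟩
    · have h5 := Metric.infDist_le_dist_of_mem (x := p + (s • T + (K * s ^ 2) • N)) hmf
      rw [hxy, dist_comm _ m, dist_comm _ y] at h5
      have h6 := h5.trans (Metric.mem_closedBall.mp hm)
      rw [dist_eq_norm] at h6
      have : y - p - s • T = (y - (p + (s • T + (K * s ^ 2) • N))) + (K * s ^ 2) • N := by module
      rw [this]
      refine (norm_add_le _ _).trans ?_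
      rw [norm_smul, hN, Real.norm_of_nonneg hKs2.le]
      linarith
    · rw [add_sub_cancel]
      exact hGk _ _ hpos hy hxy
  obtain ⟨d, hd⟩ := skolem.mp hpt
  have hd1 : Tendsto (fun s => s⁻¹ • (d s - s • T)) (𝓝[>] 0) (𝓝 0) := by
    have hz : Tendsto (fun s : ℝ => 3 * K * s) (𝓝[>] 0) (𝓝 0) := by
      simpa using hs0.const_mul (3 * K)
    refine squeeze_zero_norm' ?_ hz
    filter_upwards [hd, self_mem_nhdsWithin] with s hs h3
    have h3' : 0 < s := h3
    rw [norm_smul, norm_inv, Real.norm_of_nonneg h3'.le, inv_mul_le_iff₀ h3']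
    exact hs.1.trans_eq (by ring)
  have hdv : Tendsto (fun s => s⁻¹ • d s) (𝓝[>] 0) (𝓝 T) := by
    have := hd1.add (hinv.smul_const T)
    rw [zero_add, one_smul] at this
    refine this.congr fun s => ?_
    rw [smul_sub, smul_smul, sub_add_cancel]
  have hd0 : Tendsto d (𝓝[>] 0) (𝓝 0) := by
    have := hs0.smul hdv
    rw [zero_smul] at this
    refine this.congr' ?_
    filter_upwards [self_mem_nhdsWithin] with s h3
    rw [smul_smul, mul_inv_cancel₀ (ne_of_gt h3), one_smul]
  have he0 : Tendsto (fun s : ℝ => s • T + (K * s ^ 2) • N) (𝓝[>] 0) (𝓝 0) := by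
    have : Continuous fun s : ℝ => s • T + (K * s ^ 2) • N := by fun_prop
    simpa using (this.tendsto 0).mono_left nhdsWithin_le_nhds
  have hev : Tendsto (fun s : ℝ => s⁻¹ • (s • T + (K * s ^ 2) • N)) (𝓝[>] 0) (𝓝 T) := by
    have : Continuous fun s : ℝ => T + (K * s) • N := by fun_prop
    have h := (this.tendsto 0).mono_left (nhdsWithin_le_nhds (s := Set.Ioi 0))
    simp only [mul_zero, zero_smul, add_zero] at h
    refine h.congr' ?_
    filter_upwards [self_mem_nhdsWithin] with s h3
    have h3' : s ≠ 0 := ne_of_gt h3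
    rw [smul_add, smul_smul, smul_smul, inv_mul_cancel₀ h3', one_smul]
    congr 2
    field_simp
  have hDc : Tendsto (fun s => ‖fderiv ℝ ρ (p + d s)‖) (𝓝[>] 0) (𝓝 ‖fderiv ℝ ρ p‖) := by
    have hc := (contDiff_fderiv_of_contDiff hρ).continuous.norm
    have := (hc.tendsto p).comp (show Tendsto (fun s => p + d s) (𝓝[>] 0) (𝓝 p) by
      simpa using hd0.const_add p)
    exact this
  refine le_of_tendsto_of_tendsto ((hlim he0 hev hG).norm.mul hDc) (hlim hd0 hdv hk).norm ?_
  filter_upwards [hd, self_mem_nhdsWithin] with s hs h3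
  have h3' : 0 < s := h3
  simp only [hGp, hkp, sub_zero, norm_smul, norm_inv, Real.norm_of_nonneg h3'.le]
  rw [mul_assoc]
  exact mul_le_mul_of_nonneg_left hs.2 (by positivity)

end Nearest

/-! ### The mixed derivative of the signed distance -/

/-- Where the distance is differentiable, its differential at `x` and `dρ` at `y` are nonnegative
multiples of `⟪x - y, ·⟫`, the former of norm one, and equality holds. Elsewhere `dzbar` is `0` by
default. This is the input for `fderiv_bound_of_nearest`. -/
lemma norm_dzbar_signedDist_le {n : ℕ} (j : Fin n) {ρ : Cn n → ℝ} {Ω : Set (Cn n)}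
    (hρ : ContDiff ℝ ∞ ρ) (hΩ : Ω = {x | ρ x < 0}) {x y : Cn n} (hx : 0 < ρ x)
    (hy : y ∈ frontier Ω) (hxy : Metric.infDist x (frontier Ω) = dist x y) :
    ‖dzbar j (fun z => (signedDist Ω z : ℂ)) x‖ * ‖fderiv ℝ ρ y‖
      ≤ ‖(1 / 2 : ℝ) • coeff j (fderiv ℝ ρ y)‖ := by
  have heq : signedDist Ω =ᶠ[𝓝 x] fun z => Metric.infDist z (frontier Ω) := by
    filter_upwards [hρ.continuous.continuousAt.eventually_const_lt hx] with z hz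
    rw [signedDist, if_neg]
    rw [hΩ]
    exact not_lt.mpr hz.le
  by_cases hd : DifferentiableAt ℝ (fun z => (signedDist Ω z : ℂ)) x
  · have hd1 : DifferentiableAt ℝ (signedDist Ω) x :=
      (Complex.reCLM.differentiableAt.comp x hd :)
    have hd2 : DifferentiableAt ℝ (fun z => Metric.infDist z (frontier Ω)) x :=
      hd1.congr_of_eventuallyEq heq.symm
    obtain ⟨hne, μ, hμ, h⟩ := fderiv_eq_smul_of_nearest hρ hx (hΩ ▸ hy) (hΩ ▸ hxy)
    have hL := fderiv_infDist_eq hy hxy hne hd2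
    rw [← heq.fderiv_eq] at hL
    have hn : ‖x - y‖ ≠ 0 := by simpa [sub_eq_zero] using hne
    have hscale : ‖fderiv ℝ ρ y‖ • fderiv ℝ (signedDist Ω) x = fderiv ℝ ρ y := by
      rw [hL, h, norm_smul, innerSL_apply_norm, Real.norm_of_nonneg hμ, smul_smul]
      congr 1
      field_simp
    rw [dzbar_ofReal j hd1.hasFDerivAt]
    have hconj : fderiv ℝ (signedDist Ω) x (EuclideanSpace.single j 1) + Complex.I *
        fderiv ℝ (signedDist Ω) x (EuclideanSpace.single j Complex.I)
        = (starRingEnd ℂ) (coeff j (fderiv ℝ (signedDist Ω) x)) := by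
      simp [coeff_apply]
    rw [hconj]
    conv_rhs => rw [← hscale, map_smul]
    simp only [norm_div, norm_smul, RCLike.norm_conj]
    apply le_of_eq
    simp
    ring
  · have h0 : dzbar j (fun z => (signedDist Ω z : ℂ)) x = 0 := by
      simp [dzbar, fderiv_zero_of_not_differentiableAt hd]
    rw [h0, norm_zero, zero_mul]
    exact norm_nonneg _

lemma inner_single_one (ν : ℂ) (v : Cn 2) :
    inner ℝ (EuclideanSpace.single 1 ν) v = ((starRingEnd ℂ) ν * v 1).re := by
  simp [PiLp.inner_apply, Fin.sum_univ_two, Complex.inner]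
  ring

/-- At a boundary point where the complex normal is the `w`-direction, the mixed second derivative
of the signed distance is controlled by the second derivatives of any defining function. -/
lemma norm_mixedDeriv_signedDist_le {ρ : Cn 2 → ℝ} {Ω : Set (Cn 2)} (hρ : ContDiff ℝ ∞ ρ)
    (hΩ : Ω = {x | ρ x < 0}) {p : Cn 2} (hp : p ∈ frontier Ω) (h0 : coeff 0 (fderiv ℝ ρ p) = 0)
    {c : ℂ} (hc : coeff 1 (fderiv ℝ ρ p) = c) (hc0 : c ≠ 0) :
    ‖mixedDeriv 1 0 (signedDist Ω) p‖ * (4 * ‖c‖) ≤ ‖coeff 0 (fderiv ℝ (fderiv ℝ ρ) p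
      (EuclideanSpace.single 1 (Complex.I * ((starRingEnd ℂ) c / ‖c‖))))‖ := by
  set G : Cn 2 → ℂ := dzbar 0 (fun z => (signedDist Ω z : ℂ)) with hGdef
  by_cases hd : DifferentiableAt ℝ G p
  swap
  · have : mixedDeriv 1 0 (signedDist Ω) p = 0 := by
      rw [mixedDeriv, ← hGdef, dz, fderiv_zero_of_not_differentiableAt hd]
      simp
    rw [this, norm_zero, zero_mul]
    exact norm_nonneg _
  have hcn : 0 < ‖c‖ := norm_pos_iff.mpr hc0
  set ν : ℂ := (starRingEnd ℂ) c / ‖c‖ with hν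
  have hν1 : ‖ν‖ = 1 := by simp [hν, hcn.ne']
  have hνc : (starRingEnd ℂ) ν = c / ‖c‖ := by simp [hν]
  have hgrad : ∀ v, fderiv ℝ ρ p v = ‖c‖ * inner ℝ (EuclideanSpace.single 1 ν) v := by
    intro v
    conv_lhs => rw [eq_single_add_single v]
    rw [map_add, apply_single, apply_single, h0, hc, inner_single_one, hνc, ← Complex.re_ofReal_mul]
    have : (‖c‖ : ℂ) ≠ 0 := by exact_mod_cast hcn.ne'
    rw [zero_mul, Complex.zero_re, zero_add]
    congr 1
    field_simp
  have hk : HasFDerivAt (fun q => (1 / 2 : ℝ) • coeff 0 (fderiv ℝ ρ q))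
      ((1 / 2 : ℝ) • (coeff 0).comp (fderiv ℝ (fderiv ℝ ρ) p)) p := by
    have h := (coeff 0).hasFDerivAt.comp p
      (hasFDerivAt_fderiv_of_contDiff (contDiff_fderiv_of_contDiff hρ) p)
    exact h.const_smul (1 / 2 : ℝ)
  obtain ⟨hN, hT⟩ := fderiv_bound_of_nearest (T := EuclideanSpace.single 1 (Complex.I * ν)) hρ
    (hΩ ▸ hp) hcn hgrad (by simp [hν1]) (by simp [hν1])
    (by
      rw [inner_single_one]
      have : (starRingEnd ℂ) ν * (Complex.I * ν) = Complex.I * (Complex.normSq ν : ℂ) := by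
        rw [Complex.normSq_eq_conj_mul_self]; ring
      simp [this])
    hd.hasFDerivAt hk (by simp [h0])
    (fun x y hx hy hxy => norm_dzbar_signedDist_le 0 hρ hΩ hx (hΩ ▸ hy) (hΩ ▸ hxy))
  have hnD : ‖fderiv ℝ ρ p‖ = ‖c‖ := by
    have : fderiv ℝ ρ p = ‖c‖ • innerSL ℝ (EuclideanSpace.single 1 ν : Cn 2) := by
      ext v; simpa using hgrad v
    rw [this, norm_smul, innerSL_apply_norm]
    simp [hν1]
  have hsq : ν.re * ν.re + ν.im * ν.im = 1 := by
    rw [← Complex.normSq_apply, Complex.normSq_eq_norm_sq, hν1, one_pow]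
  have e1 : (EuclideanSpace.single 1 1 : Cn 2) = ν.re • EuclideanSpace.single 1 ν
      - ν.im • EuclideanSpace.single 1 (Complex.I * ν) := by
    ext k
    fin_cases k
    · simp
    · apply Complex.ext <;> simp <;> linarith
  have e2 : (EuclideanSpace.single 1 Complex.I : Cn 2) = ν.im • EuclideanSpace.single 1 ν
      + ν.re • EuclideanSpace.single 1 (Complex.I * ν) := by
    ext k
    fin_cases k
    · simp
    · apply Complex.ext <;> simp <;> linarith
  -- In the real basis `ν`, `iν` of the `w`-line the normal derivative of `G` vanishes, so only the
  -- derivative along `iν` survives in `∂/∂w`.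
  have hmix : mixedDeriv 1 0 (signedDist Ω) p = -Complex.I * (starRingEnd ℂ) ν / 2 *
      fderiv ℝ G p (EuclideanSpace.single 1 (Complex.I * ν)) := by
    rw [mixedDeriv, ← hGdef, dz, e1, e2]
    simp only [map_add, map_sub, map_smul, hN, smul_zero, zero_add, zero_sub, Complex.real_smul]
    have : (starRingEnd ℂ) ν = ν.re - Complex.I * ν.im := by
      apply Complex.ext <;> simp
    rw [this]
    linear_combination (-(1 / 2 : ℂ)) * ν.im
      * fderiv ℝ G p (EuclideanSpace.single 1 (Complex.I * ν)) * Complex.I_sq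
  rw [hnD] at hT
  simp only [smul_apply, ContinuousLinearMap.comp_apply, norm_smul] at hT
  rw [hmix, norm_mul, norm_div, norm_mul, norm_neg, Complex.norm_I, RCLike.norm_conj, hν1]
  norm_num at hT ⊢
  linarith

/-- By symmetry of `D²ρ`, the `z`-coefficient `m` in the tangential direction `t` is determined by
the `w`-coefficients in the directions `z` and `iz`. The second vanishes by `hy`, so `mz` is real,
and `ct = i|c|` turns the first into `-|c| Im a`. -/
lemma norm_mixedDeriv_signedDist_mul_le {ρ : Cn 2 → ℝ} {Ω : Set (Cn 2)} (hρ : ContDiff ℝ ∞ ρ)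
    (hΩ : Ω = {x | ρ x < 0}) {p : Cn 2} (hp : p ∈ frontier Ω) (h0 : coeff 0 (fderiv ℝ ρ p) = 0)
    {c z a : ℂ} (hc : coeff 1 (fderiv ℝ ρ p) = c) (hc0 : c ≠ 0)
    (ha : coeff 1 (fderiv ℝ (fderiv ℝ ρ) p (EuclideanSpace.single 0 z)) = a * c)
    (hy : coeff 1 (fderiv ℝ (fderiv ℝ ρ) p (EuclideanSpace.single 0 (Complex.I * z))) = 0) :
    ‖mixedDeriv 1 0 (signedDist Ω) p‖ * (4 * ‖z‖) ≤ |a.im| := by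
  have hcn : 0 < ‖c‖ := norm_pos_iff.mpr hc0
  have h := norm_mixedDeriv_signedDist_le hρ hΩ hp h0 hc hc0
  set t : ℂ := Complex.I * ((starRingEnd ℂ) c / ‖c‖) with ht
  set m := coeff 0 (fderiv ℝ (fderiv ℝ ρ) p (EuclideanSpace.single 1 t)) with hm
  have e1 : (m * z).re = (a * c * t).re := by
    rw [hm, ← apply_single, fderiv_fderiv_symm hρ, apply_single, ha]
  have e2 : (m * (Complex.I * z)).re = 0 := by
    rw [hm, ← apply_single, fderiv_fderiv_symm hρ, apply_single, hy]
    simp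
  have e3 : a * c * t = a * Complex.I * ‖c‖ := by
    have h1 : c * (starRingEnd ℂ) c = ‖c‖ ^ 2 := Complex.mul_conj' c
    have h2 : (‖c‖ : ℂ) ≠ 0 := by exact_mod_cast hcn.ne'
    rw [ht]
    field_simp
    linear_combination a * h1
  have e4 : m * z = ((-(a.im * ‖c‖) : ℝ) : ℂ) := by
    apply Complex.ext
    · rw [e1, e3]; simp
    · have : m * (Complex.I * z) = Complex.I * (m * z) := by ring
      rw [this] at e2
      simp only [Complex.mul_re, Complex.I_re, Complex.I_im] at e2
      rw [Complex.ofReal_im]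
      linarith
  have e5 : ‖m‖ * ‖z‖ = |a.im| * ‖c‖ := by
    rw [← norm_mul, e4, Complex.norm_real, Real.norm_eq_abs, abs_neg, abs_mul, abs_of_pos hcn]
  have := mul_le_mul_of_nonneg_right h (norm_nonneg z)
  rw [e5] at this
  refine le_of_mul_le_mul_right (this.trans' (le_of_eq (by ring))) hcn

/-! ### Extremality conditions for a curve in the plane -/

section OneVariable

variable {F F' : ℝ → ℂ} {F'' : ℂ}

lemma hasDerivAt_re {x : ℝ} {f' : ℂ} (h : HasDerivAt F f' x) :
    HasDerivAt (fun t => (F t).re) f'.re x :=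
  Complex.reCLM.hasFDerivAt.comp_hasDerivAt x h

lemma hasDerivAt_im {x : ℝ} {f' : ℂ} (h : HasDerivAt F f' x) :
    HasDerivAt (fun t => (F t).im) f'.im x :=
  Complex.imCLM.hasFDerivAt.comp_hasDerivAt x h

/-- A curve in a real line through `0` whose modulus is minimal at `0` is stationary there. -/
lemma stationary_of_norm_le (h1 : ∀ t, HasDerivAt F (F' t) t) (h2 : HasDerivAt F' F'' 0)
    (h0 : F 0 ≠ 0) (hreal : ∀ t, (F t * (starRingEnd ℂ) (F 0)).im = 0)
    (hmin : ∀ t, ‖F 0‖ ≤ ‖F t‖) : F' 0 = 0 ∧ 0 ≤ (F'' / F 0).re := by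
  set f := F 0 with hf
  have hfn : 0 < ‖f‖ := norm_pos_iff.mpr h0
  have hff : f * (starRingEnd ℂ) f = ((‖f‖ ^ 2 : ℝ) : ℂ) := by
    rw [Complex.mul_conj']; norm_cast
  have d1 := fun t => (h1 t).mul_const ((starRingEnd ℂ) f)
  have d2 := h2.mul_const ((starRingEnd ℂ) f)
  have hpos : ∀ᶠ t in 𝓝 (0 : ℝ), 0 < (F t * (starRingEnd ℂ) f).re := by
    refine (hasDerivAt_re (d1 0)).continuousAt.eventually_const_lt ?_
    change 0 < (f * (starRingEnd ℂ) f).re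
    rw [hff, Complex.ofReal_re]
    positivity
  -- Since `F t` lies on the real line through `f`, this real part equals `‖F t‖ * ‖f‖` while it is
  -- positive.
  have hlm : IsLocalMin (fun t => (F t * (starRingEnd ℂ) f).re) 0 := by
    filter_upwards [hpos] with t ht
    have e : F t * (starRingEnd ℂ) f = (((F t * (starRingEnd ℂ) f).re : ℝ) : ℂ) :=
      Complex.ext (by simp) (by rw [hreal t, Complex.ofReal_im])
    have e2 : ‖F t‖ * ‖f‖ = (F t * (starRingEnd ℂ) f).re := by
      rw [← RCLike.norm_conj f, ← norm_mul, e, Complex.norm_real, Real.norm_of_nonneg ht.le,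
        Complex.ofReal_re]
    rw [← e2, ← hf, hff, Complex.ofReal_re, sq]
    exact mul_le_mul_of_nonneg_right (hmin t) hfn.le
  obtain ⟨r1, r2⟩ := nonneg_of_isLocalMin_of_hasDerivAt hlm
    (.of_forall fun t => hasDerivAt_re (d1 t)) (hasDerivAt_re d2)
  have i1 : (F' 0 * (starRingEnd ℂ) f).im = 0 :=
    (hasDerivAt_im (d1 0)).unique ((hasDerivAt_const (0 : ℝ) (0 : ℝ)).congr_of_eventuallyEq
      (.of_forall fun t => hreal t))
  refine ⟨?_, ?_⟩
  · have : F' 0 * (starRingEnd ℂ) f = 0 := Complex.ext r1 i1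
    simpa [h0] using this
  · have : F'' / f = ((‖f‖ ^ 2)⁻¹ : ℝ) * (F'' * (starRingEnd ℂ) f) := by
      have hcf : (starRingEnd ℂ) f ≠ 0 := by simpa using h0
      rw [Complex.ofReal_inv, ← hff]
      field_simp
    rw [this, Complex.re_ofReal_mul]
    positivity

/-- First- and second-order conditions for `sin (θ + η t) / |F t| ^ κ` to be maximal at `0`. -/
lemma second_order_of_sin_le {θ η κ : ℝ} {a q : ℂ} (hκ : 0 < κ)
    (hθ : 0 < Real.sin θ)
    (h1 : ∀ t, HasDerivAt F (F' t) t) (h2 : HasDerivAt F' (q * F 0) 0) (h0 : F 0 ≠ 0)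
    (ha : F' 0 = a * F 0)
    (hmax : ∀ᶠ t in 𝓝 (0 : ℝ),
      Real.sin (θ + η * t) * ‖F 0‖ ^ κ ≤ Real.sin θ * ‖F t‖ ^ κ) :
    a.re ^ 2 - a.im ^ 2 - η ^ 2 / κ - κ * a.re ^ 2 ≤ q.re := by
  have hlin : ∀ t, HasDerivAt (fun t : ℝ => θ + η * t) η t := fun t => by
    simpa using ((hasDerivAt_id t).const_mul η).const_add θ
  have dsin : ∀ t, HasDerivAt (fun t : ℝ => Real.sin (θ + η * t)) (Real.cos (θ + η * t) * η) t :=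
    fun t => (hlin t).sin
  have dcos : ∀ t, HasDerivAt (fun t : ℝ => Real.cos (θ + η * t)) (-Real.sin (θ + η * t) * η) t :=
    fun t => (hlin t).cos
  have dN : ∀ t, HasDerivAt (fun t => (F t).re ^ 2 + (F t).im ^ 2)
      (2 * ((F t).re * (F' t).re + (F t).im * (F' t).im)) t := fun t =>
    (((hasDerivAt_re (h1 t)).pow 2).add ((hasDerivAt_im (h1 t)).pow 2)).congr_deriv (by
      simp; ring)
  have dN' : HasDerivAt (fun t => 2 * ((F t).re * (F' t).re + (F t).im * (F' t).im))
      _ 0 := (((hasDerivAt_re (h1 0)).mul (hasDerivAt_re h2)).add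
        ((hasDerivAt_im (h1 0)).mul (hasDerivAt_im h2))).const_mul 2
  have hN0 : 0 < (F 0).re ^ 2 + (F 0).im ^ 2 := by
    have := Complex.normSq_pos.mpr h0
    rw [Complex.normSq_apply] at this
    nlinarith
  have hNn : ∀ t, (F t).re ^ 2 + (F t).im ^ 2 = ‖F t‖ ^ 2 := fun t => by
    rw [← Complex.normSq_eq_norm_sq, Complex.normSq_apply]; ring
  have evN : ∀ᶠ t in 𝓝 (0 : ℝ), 0 < (F t).re ^ 2 + (F t).im ^ 2 :=
    (dN 0).continuousAt.eventually_const_lt hN0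
  have evs : ∀ᶠ t in 𝓝 (0 : ℝ), 0 < Real.sin (θ + η * t) :=
    (dsin 0).continuousAt.eventually_const_lt (by simpa using hθ)
  -- Minus the logarithm of the maximized quotient; its first two derivatives are explicit.
  set g : ℝ → ℝ := fun t => κ / 2 * Real.log ((F t).re ^ 2 + (F t).im ^ 2)
    - Real.log (Real.sin (θ + η * t)) with hg
  have hlog : ∀ t, 0 < (F t).re ^ 2 + (F t).im ^ 2 → 0 < Real.sin (θ + η * t) →
      g t = Real.log (‖F t‖ ^ κ) - Real.log (Real.sin (θ + η * t)) := by
    intro t ht _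
    rw [hNn] at ht
    have : 0 < ‖F t‖ := by
      rcases (norm_nonneg (F t)).eq_or_lt' with h | h
      · simp [h] at ht
      · exact h
    simp only [hg]
    rw [hNn, Real.log_rpow this, Real.log_pow]
    push_cast
    ring
  have hlm : IsLocalMin g 0 := by
    filter_upwards [evN, evs, hmax] with t e1 e2 e3
    rw [hlog t e1 e2, hlog 0 hN0 (by simpa using hθ)]
    rw [hNn] at e1
    have p1 : 0 < ‖F t‖ ^ κ := by
      refine Real.rpow_pos_of_pos (lt_of_le_of_ne (norm_nonneg _) fun h => ?_) _
      rw [← h] at e1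
      simp at e1
    have p0 : 0 < ‖F 0‖ ^ κ := Real.rpow_pos_of_pos (norm_pos_iff.mpr h0) _
    have := Real.log_le_log (mul_pos e2 p0) e3
    rw [Real.log_mul e2.ne' p0.ne', Real.log_mul hθ.ne' p1.ne'] at this
    simp only [mul_zero, add_zero]
    linarith
  have dg : ∀ᶠ t in 𝓝 (0 : ℝ), HasDerivAt g
      (κ / 2 * ((2 * ((F t).re * (F' t).re + (F t).im * (F' t).im))
        / ((F t).re ^ 2 + (F t).im ^ 2)) - Real.cos (θ + η * t) * η / Real.sin (θ + η * t)) t := by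
    filter_upwards [evN, evs] with t e1 e2
    exact (((dN t).log e1.ne').const_mul (κ / 2)).sub ((dsin t).log e2.ne')
  have dg' := ((dN'.div (dN 0) hN0.ne').const_mul (κ / 2)).sub
    (((dcos 0).mul_const η).div (dsin 0) (by simpa using hθ.ne'))
  obtain ⟨r1, r2⟩ := nonneg_of_isLocalMin_of_hasDerivAt hlm dg dg'
  have hθ' := hθ.ne'
  have hsc := Real.sin_sq_add_cos_sq θ
  have eN1 : (F 0).re * (F' 0).re + (F 0).im * (F' 0).im
      = a.re * ((F 0).re ^ 2 + (F 0).im ^ 2) := by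
    rw [ha]; simp; ring
  have eN2 : (F 0).re * (q * F 0).re + (F 0).im * (q * F 0).im
      = q.re * ((F 0).re ^ 2 + (F 0).im ^ 2) := by
    simp; ring
  have eN3 : (F' 0).re * (F' 0).re + (F' 0).im * (F' 0).im
      = (a.re ^ 2 + a.im ^ 2) * ((F 0).re ^ 2 + (F 0).im ^ 2) := by
    rw [ha]; simp; ring
  simp only [mul_zero, add_zero] at r1 r2
  have eN4 : 2 * ((F' 0).re * (F' 0).re + (F 0).re * (q * F 0).re
      + ((F' 0).im * (F' 0).im + (F 0).im * (q * F 0).im))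
      = 2 * (a.re ^ 2 + a.im ^ 2 + q.re) * ((F 0).re ^ 2 + (F 0).im ^ 2) := by
    linear_combination 2 * eN2 + 2 * eN3
  rw [eN4, eN1] at r2
  rw [eN1] at r1
  set N := (F 0).re ^ 2 + (F 0).im ^ 2
  set s := Real.sin θ
  set k := Real.cos θ
  have hk : k * η = κ * a.re * s := by
    field_simp at r1
    linarith
  have r3 : 0 ≤ κ * (a.re ^ 2 + a.im ^ 2 + q.re - 2 * a.re ^ 2) + η ^ 2 / s ^ 2 := by
    refine r2.trans_eq ?_
    have hN := hN0.ne'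
    field_simp
    linear_combination η ^ 2 * hsc
  -- The first-order condition `hk` with `sin² + cos² = 1` eliminates `θ`.
  have r4 : η ^ 2 / s ^ 2 = η ^ 2 + κ ^ 2 * a.re ^ 2 := by
    field_simp
    linear_combination (-η ^ 2) * hsc + (k * η + κ * a.re * s) * hk
  rw [r4] at r3
  have e5 : a.re ^ 2 - a.im ^ 2 - η ^ 2 / κ - κ * a.re ^ 2
      = q.re - (κ * (a.re ^ 2 + a.im ^ 2 + q.re - 2 * a.re ^ 2) + (η ^ 2 + κ ^ 2 * a.re ^ 2)) / κ := by
    field_simp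
    ring
  rw [e5]
  have := div_nonneg r3 hκ.le
  linarith

end OneVariable

/-! ### Logarithmic coordinates in the complex line -/

lemma hasDerivAt_single {n : ℕ} (j : Fin n) {γ : ℝ → ℂ} {γ' : ℂ} {t : ℝ}
    (h : HasDerivAt γ γ' t) :
    HasDerivAt (fun t => (EuclideanSpace.single j (γ t) : Cn n)) (EuclideanSpace.single j γ') t := by
  rw [single_eq_smul]
  simp_rw [fun t => single_eq_smul j (γ t)]
  exact ((hasDerivAt_re h).smul_const _).add ((hasDerivAt_im h).smul_const _)

section Curves

variable {ρ : Cn 2 → ℝ} (z w l : ℂ)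

/-- Used with `l = 1`, which moves `log |z|`, and `l = i`, which moves `arg z`. Their accelerations
`l²z` at `t = 0` are opposite, so they cancel when the two second derivatives are added. -/
lemma hasDerivAt_exp_curve (t : ℝ) :
    HasDerivAt (fun t : ℝ => z * Complex.exp (t * l)) (l * z * Complex.exp (t * l)) t := by
  have h : HasDerivAt (fun t : ℝ => (t : ℂ) * l) l t := by
    simpa using (Complex.ofRealCLM.hasDerivAt (x := t)).mul_const l
  exact (h.cexp.const_mul z).congr_deriv (by ring)

lemma hasDerivAt_point_curve (t : ℝ) :
    HasDerivAt (fun t : ℝ => (EuclideanSpace.single 0 (z * Complex.exp (t * l))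
      + EuclideanSpace.single 1 w : Cn 2))
      (EuclideanSpace.single 0 (l * z * Complex.exp (t * l))) t :=
  (hasDerivAt_single 0 (hasDerivAt_exp_curve z l t)).add_const _

lemma hasDerivAt_coeff_curve (hρ : ContDiff ℝ ∞ ρ) (t : ℝ) :
    HasDerivAt (fun t : ℝ => coeff 1 (fderiv ℝ ρ (EuclideanSpace.single 0 (z * Complex.exp (t * l))
      + EuclideanSpace.single 1 w)))
      (coeff 1 (fderiv ℝ (fderiv ℝ ρ) (EuclideanSpace.single 0 (z * Complex.exp (t * l))
      + EuclideanSpace.single 1 w) (EuclideanSpace.single 0 (l * z * Complex.exp (t * l))))) t :=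
  (coeff 1).hasFDerivAt.comp_hasDerivAt t (hasDerivAt_fderiv_comp (contDiff_fderiv_of_contDiff hρ)
    (hasDerivAt_point_curve z w l t))

lemma hasDerivAt_coeff_curve' (hρ : ContDiff ℝ ∞ ρ) :
    HasDerivAt (fun t : ℝ => coeff 1 (fderiv ℝ (fderiv ℝ ρ)
      (EuclideanSpace.single 0 (z * Complex.exp (t * l)) + EuclideanSpace.single 1 w)
      (EuclideanSpace.single 0 (l * z * Complex.exp (t * l)))))
      (coeff 1 (fderiv ℝ (fderiv ℝ (fderiv ℝ ρ)) (EuclideanSpace.single 0 z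
          + EuclideanSpace.single 1 w) (EuclideanSpace.single 0 (l * z))
          (EuclideanSpace.single 0 (l * z))
        + fderiv ℝ (fderiv ℝ ρ) (EuclideanSpace.single 0 z + EuclideanSpace.single 1 w)
          (EuclideanSpace.single 0 (l * (l * z))))) 0 := by
  have h := (hasDerivAt_fderiv_comp (contDiff_fderiv_of_contDiff (contDiff_fderiv_of_contDiff hρ))
    (hasDerivAt_point_curve z w l 0)).clm_apply
    (hasDerivAt_single 0 (hasDerivAt_exp_curve (l * z) l 0))
  have h2 := (coeff 1).hasFDerivAt.comp_hasDerivAt 0 h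
  refine h2.congr_deriv ?_
  simp

end Curves

/-! ### The defining function along the annulus -/

section Annulus

variable {ρ : Cn 2 → ℝ} {Ω : Set (Cn 2)} {w : ℂ}

/-- A defining function vanishes to second order along an open piece of a complex line contained
in the boundary. -/
lemma fderiv_along_line_eq_zero (hρ : ContDiff ℝ ∞ ρ) {z : ℂ}
    (h : ∀ᶠ ζ in 𝓝 z, ρ (EuclideanSpace.single 0 ζ + EuclideanSpace.single 1 w) = 0) :
    (∀ a, fderiv ℝ ρ (EuclideanSpace.single 0 z + EuclideanSpace.single 1 w)
      (EuclideanSpace.single 0 a) = 0) ∧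
    ∀ a b, fderiv ℝ (fderiv ℝ ρ) (EuclideanSpace.single 0 z + EuclideanSpace.single 1 w)
      (EuclideanSpace.single 0 a) (EuclideanSpace.single 0 b) = 0 := by
  have hline : ∀ ζ a : ℂ, HasDerivAt (fun t : ℝ => (EuclideanSpace.single 0 (ζ + t * a)
      + EuclideanSpace.single 1 w : Cn 2)) (EuclideanSpace.single 0 a) 0 := fun ζ a => by
    have : HasDerivAt (fun t : ℝ => ζ + (t : ℂ) * a) a 0 := by
      simpa using ((Complex.ofRealCLM.hasDerivAt (x := 0)).mul_const a).const_add ζ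
    exact (hasDerivAt_single 0 this).add_const _
  have hto : ∀ ζ a : ℂ, Tendsto (fun t : ℝ => ζ + (t : ℂ) * a) (𝓝 0) (𝓝 ζ) := fun ζ a => by
    have : Continuous fun t : ℝ => ζ + (t : ℂ) * a := by fun_prop
    simpa using this.tendsto 0
  have h1 : ∀ᶠ ζ in 𝓝 z, ∀ a, fderiv ℝ ρ (EuclideanSpace.single 0 ζ + EuclideanSpace.single 1 w)
      (EuclideanSpace.single 0 a) = 0 := by
    filter_upwards [h.eventually_nhds] with ζ hζ a
    have hd := hasDerivAt_fderiv_comp hρ (hline ζ a)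
    have := hd.unique ((hasDerivAt_const (0 : ℝ) (0 : ℝ)).congr_of_eventuallyEq
      ((hto ζ a).eventually hζ))
    simpa using this
  refine ⟨h1.self_of_nhds, fun a b => ?_⟩
  have hd := (hasDerivAt_fderiv_comp (contDiff_fderiv_of_contDiff hρ) (hline z a)).clm_apply
    (hasDerivAt_const (0 : ℝ) (EuclideanSpace.single 0 b : Cn 2))
  have := hd.unique ((hasDerivAt_const (0 : ℝ) (0 : ℝ)).congr_of_eventuallyEq
    ((hto z a).eventually (h1.mono fun ζ hζ => hζ b)))
  simpa using this

lemma point_eq (z w : ℂ) :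
    (EuclideanSpace.single 0 z + EuclideanSpace.single 1 w : Cn 2) = !₂[z, w] := by
  ext k; fin_cases k <;> simp

/-- On a Hartogs domain the direction of the `w`-component of the normal is constant along the
circles `|z| = const`, at boundary points. -/
lemma coeff_rotate_im_eq_zero (hρ : ContDiff ℝ ∞ ρ) (hΩ : Ω = {x | ρ x < 0}) (hH : IsHartogs Ω)
    {z : ℂ} (θ : ℝ) (h0 : ρ (EuclideanSpace.single 0 z + EuclideanSpace.single 1 w) = 0)
    (h1 : ρ (EuclideanSpace.single 0 (z * Complex.exp (θ * Complex.I))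
      + EuclideanSpace.single 1 w) = 0) :
    (coeff 1 (fderiv ℝ ρ (EuclideanSpace.single 0 (z * Complex.exp (θ * Complex.I))
        + EuclideanSpace.single 1 w))
      * (starRingEnd ℂ) (coeff 1 (fderiv ℝ ρ (EuclideanSpace.single 0 z
        + EuclideanSpace.single 1 w)))).im = 0 := by
  set p : Cn 2 := EuclideanSpace.single 0 z + EuclideanSpace.single 1 w with hp
  set p' : Cn 2 := EuclideanSpace.single 0 (z * Complex.exp (θ * Complex.I))
    + EuclideanSpace.single 1 w with hp'
  set f := coeff 1 (fderiv ℝ ρ p) with hf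
  by_cases hf0 : f = 0
  · simp [hf0]
  have hline : ∀ (q : Cn 2) (u : ℂ), HasDerivAt (fun t : ℝ => q + t • EuclideanSpace.single 1 u)
      (EuclideanSpace.single 1 u) 0 := fun q u => by
    simpa using ((hasDerivAt_id (0 : ℝ)).smul_const (EuclideanSpace.single 1 u : Cn 2)).const_add q
  have hslope : ∀ (q : Cn 2) (u : ℂ), ρ q = 0 → Tendsto
      (fun t : ℝ => t⁻¹ * ρ (q + t • EuclideanSpace.single 1 u)) (𝓝[>] 0)
      (𝓝 (fderiv ℝ ρ q (EuclideanSpace.single 1 u))) := fun q u hq => by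
    have := (hasDerivAt_fderiv_comp hρ (hline q u)).tendsto_slope.mono_left
      (nhdsGT_le_nhdsNE (0 : ℝ))
    simp only [zero_smul, add_zero] at this
    refine this.congr fun ε => ?_
    simp [slope, hq]
  -- A direction entering `Ω` at `p` is carried by the rotation, which fixes `w`, to one along which
  -- points near `p'` lie in `Ω`. The two half-plane conditions then make the coefficients real
  -- multiples of each other.
  have key : ∀ u : ℂ, fderiv ℝ ρ p (EuclideanSpace.single 1 u) < 0 →
      fderiv ℝ ρ p' (EuclideanSpace.single 1 u) ≤ 0 := by
    intro u hu
    refine le_of_tendsto (hslope p' u h1) ?_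
    filter_upwards [(hslope p u h0).eventually_lt_const hu, self_mem_nhdsWithin] with t ht ht0
    have ht1 : (0 : ℝ) < t⁻¹ := inv_pos.mpr ht0
    have hin : ρ (p + t • EuclideanSpace.single 1 u) < 0 := by
      by_contra hc
      exact absurd ht (not_lt.mpr (mul_nonneg ht1.le (not_lt.mp hc)))
    have e1 : p + t • EuclideanSpace.single 1 u = !₂[z, w + t * u] := by
      rw [hp]; ext k; fin_cases k <;> simp
    have e2 : p' + t • EuclideanSpace.single 1 u
        = !₂[Complex.exp (θ * Complex.I) * z, w + t * u] := by
      rw [hp']; ext k; fin_cases k <;> simp [mul_comm]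
    have hmem : !₂[z, w + t * u] ∈ Ω := by rw [hΩ, ← e1]; exact hin
    have := hH z _ θ hmem
    rw [← e2, hΩ] at this
    exact mul_nonpos_of_nonneg_of_nonpos ht1.le (le_of_lt this)
  obtain ⟨μ, -, hμ⟩ := exists_eq_smul_of_pos_imp_nonneg
    (a := Complex.reLm ∘ₗ LinearMap.mulLeft ℝ f)
    (b := Complex.reLm ∘ₗ LinearMap.mulLeft ℝ (coeff 1 (fderiv ℝ ρ p')))
    (fun h => by
      have h := DFunLike.congr_fun h ((starRingEnd ℂ) f)
      have : (f * (starRingEnd ℂ) f).re = 0 := h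
      rw [Complex.mul_conj, Complex.ofReal_re] at this
      exact hf0 (Complex.normSq_eq_zero.mp this))
    (fun v hv => by
      have h2 := key (-v) (by
        rw [apply_single, ← hf, mul_neg, Complex.neg_re]; exact neg_neg_of_pos hv)
      rw [apply_single, mul_neg, Complex.neg_re] at h2
      exact neg_nonpos.mp h2)
  have h3 : (coeff 1 (fderiv ℝ ρ p') * (Complex.I * (starRingEnd ℂ) f)).re
      = μ * (f * (Complex.I * (starRingEnd ℂ) f)).re :=
    DFunLike.congr_fun hμ (Complex.I * (starRingEnd ℂ) f)
  have h4 : f * (Complex.I * (starRingEnd ℂ) f) = Complex.I * (Complex.normSq f : ℂ) := by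
    rw [← Complex.mul_conj]; ring
  rw [h4, mul_left_comm] at h3
  simp at h3 ⊢
  linarith

/-- At a maximum point of `sin (η (log |z| - x₀)) / |f| ^ κ`, where `f` is the `w`-component of
the differential of `ρ` and `κ = τ / (1 - τ)`, the Levi form inequality bounds the rate of rotation
of `f`. -/
lemma mul_norm_mixedDeriv_le_of_max (hρ : ContDiff ℝ ∞ ρ) (hΩ : Ω = {x | ρ x < 0})
    (hH : IsHartogs Ω) {τ κ η θ : ℝ} (hκ : (1 + κ) * (1 - τ) = 1)
    (hκ0 : 0 < κ) (hη : 0 < η) (hθ : 0 < Real.sin θ)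
    (H : ∀ q, ρ q < 0 → ∀ v, 0 ≤ (-ρ q) * (fderiv ℝ (fderiv ℝ ρ) q v v
        + fderiv ℝ (fderiv ℝ ρ) q (Complex.I • v) (Complex.I • v))
      + (1 - τ) * ((fderiv ℝ ρ q v) ^ 2 + (fderiv ℝ ρ q (Complex.I • v)) ^ 2)) {z : ℂ}
    (hfr : ∀ ζ : ℂ, ‖ζ‖ = ‖z‖ → EuclideanSpace.single 0 ζ + EuclideanSpace.single 1 w ∈ frontier Ω)
    (hz : ∀ᶠ ζ in 𝓝 z, ρ (EuclideanSpace.single 0 ζ + EuclideanSpace.single 1 w) = 0)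
    (hc0 : coeff 1 (fderiv ℝ ρ (EuclideanSpace.single 0 z + EuclideanSpace.single 1 w)) ≠ 0)
    (hmin : ∀ ζ : ℂ, ‖ζ‖ = ‖z‖ →
      ‖coeff 1 (fderiv ℝ ρ (EuclideanSpace.single 0 z + EuclideanSpace.single 1 w))‖
        ≤ ‖coeff 1 (fderiv ℝ ρ (EuclideanSpace.single 0 ζ + EuclideanSpace.single 1 w))‖)
    (hmax : ∀ᶠ t in 𝓝 (0 : ℝ), Real.sin (θ + η * t) *
      ‖coeff 1 (fderiv ℝ ρ (EuclideanSpace.single 0 z + EuclideanSpace.single 1 w))‖ ^ κ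
        ≤ Real.sin θ * ‖coeff 1 (fderiv ℝ ρ (EuclideanSpace.single 0 (z * Complex.exp (t * 1))
          + EuclideanSpace.single 1 w))‖ ^ κ) :
    ‖mixedDeriv 1 0 (signedDist Ω) (EuclideanSpace.single 0 z + EuclideanSpace.single 1 w)‖
      * (4 * ‖z‖) ≤ η / κ := by
  set p : Cn 2 := EuclideanSpace.single 0 z + EuclideanSpace.single 1 w with hp
  set f := coeff 1 (fderiv ℝ ρ p) with hf
  have hz0 : ρ p = 0 := hz.self_of_nhds
  have hvanish : ∀ ζ : ℂ, ‖ζ‖ = ‖z‖ →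
      ρ (EuclideanSpace.single 0 ζ + EuclideanSpace.single 1 w) = 0 := fun ζ hζ =>
    eq_zero_of_mem_frontier hρ.continuous (hΩ ▸ hfr ζ hζ)
  obtain ⟨hD1, hD2⟩ := fderiv_along_line_eq_zero hρ hz
  rw [← hp] at hD1 hD2
  have hrot : ∀ t : ℝ, ‖z * Complex.exp (t * Complex.I)‖ = ‖z‖ := fun t => by
    rw [norm_mul, Complex.norm_exp_ofReal_mul_I, mul_one]
  -- the angular direction
  have hy := stationary_of_norm_le (hasDerivAt_coeff_curve z w Complex.I hρ)
    (hasDerivAt_coeff_curve' z w Complex.I hρ) (by simpa using hc0)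
    (fun t => by simpa using coeff_rotate_im_eq_zero hρ hΩ hH t hz0 (hvanish _ (hrot t)))
    (fun t => by simpa using hmin _ (hrot t))
  simp only [Complex.ofReal_zero, zero_mul, Complex.exp_zero, mul_one, ← hp, ← hf] at hy
  obtain ⟨hfy, hyy⟩ := hy
  -- the radial direction
  set fx := coeff 1 (fderiv ℝ (fderiv ℝ ρ) p (EuclideanSpace.single 0 z)) with hfx
  set D := fderiv ℝ (fderiv ℝ (fderiv ℝ ρ)) p with hD
  set fxx := coeff 1 (D (EuclideanSpace.single 0 z) (EuclideanSpace.single 0 z)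
    + fderiv ℝ (fderiv ℝ ρ) p (EuclideanSpace.single 0 z)) with hfxx
  set a := fx / f with ha
  have haf : fx = a * f := by rw [ha]; field_simp
  have hx := second_order_of_sin_le (F := fun t : ℝ => coeff 1 (fderiv ℝ ρ
      (EuclideanSpace.single 0 (z * Complex.exp (t * 1)) + EuclideanSpace.single 1 w)))
    (a := a) (q := fxx / f) hκ0 hθ
    (hasDerivAt_coeff_curve z w 1 hρ)
    ((hasDerivAt_coeff_curve' z w 1 hρ).congr_deriv (by
      simp only [Complex.ofReal_zero, mul_one, Complex.exp_zero, one_mul, ← hp, ← hf]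
      field_simp
      rfl))
    (by simpa using hc0)
    (by
      simp only [Complex.ofReal_zero, mul_one, Complex.exp_zero, one_mul, ← hp, ← hf]
      rw [← haf])
    (by simpa [← hp, ← hf] using hmax)
  -- the Levi form inequality
  set s : ℂ := a.re - (starRingEnd ℂ) a * (1 + κ : ℝ) with hs
  have hU : fderiv ℝ ρ p (EuclideanSpace.single 1 (-1 / f)) = -1 := by
    rw [apply_single, ← hf]
    have : f * (-1 / f) = -1 := by field_simp
    simp [this]
  have hlevi := levi_limit (Z := EuclideanSpace.single 0 z) (U := EuclideanSpace.single 1 (-1 / f))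
    (S := EuclideanSpace.single 1 (s / f)) hρ H hz0 (hD1 _) (by rw [I_smul_single]; exact hD1 _)
    (by rw [I_smul_single, hD2, hD2, add_zero]) (by rw [hU]; norm_num)
  simp only [I_smul_single] at hlevi
  rw [hU, fderiv3_symm hρ p (EuclideanSpace.single 1 _) (EuclideanSpace.single 0 z),
    fderiv3_symm hρ p (EuclideanSpace.single 1 _) (EuclideanSpace.single 0 (Complex.I * z)),
    fderiv_fderiv_symm hρ p (EuclideanSpace.single 1 _),
    fderiv_fderiv_symm hρ p (EuclideanSpace.single 1 _)] at hlevi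
  simp only [apply_single, hfy, ← hf, ← hfx, ← hD] at hlevi
  set X := coeff 1 (D (EuclideanSpace.single 0 z) (EuclideanSpace.single 0 z)) with hX
  set Y := coeff 1 (D (EuclideanSpace.single 0 (Complex.I * z))
    (EuclideanSpace.single 0 (Complex.I * z))) with hY
  have hneg : (EuclideanSpace.single 0 (Complex.I * (Complex.I * z)) : Cn 2)
      = -EuclideanSpace.single 0 z := by
    rw [← I_smul_single, ← I_smul_single, smul_smul, Complex.I_mul_I, neg_one_smul]
  rw [hneg, map_neg, map_add, map_neg, ← hfx, ← hY] at hyy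
  rw [map_add, ← hX, ← hfx] at hfxx
  have i1 : fx * (s / f) = a * s := by rw [ha]; ring
  have i2 : X * (-1 / f) = -(fxx / f) + a := by rw [hfxx, ha]; ring
  have i3 : Y * (-1 / f) = -((Y + -fx) / f) - a := by rw [ha]; ring
  have i4 : fx * (-1 / f) = -a := by rw [ha]; ring
  have i5 : f * (s / f) = s := by field_simp
  have i6 : f * (Complex.I * (s / f)) = Complex.I * s := by field_simp
  rw [i1, i2, i3, i4, i5, i6] at hlevi
  have sre : s.re = -κ * a.re := by rw [hs]; simp; ring
  have sim : s.im = (1 + κ) * a.im := by rw [hs]; simp; ring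
  simp only [Complex.add_re, Complex.neg_re, Complex.sub_re, Complex.mul_re, Complex.I_re,
    Complex.I_im, zero_mul, Complex.zero_re, sre, sim] at hlevi
  -- The Levi inequality reads `Re (f_xx/f) + Re (f_yy/f) ≤ (1-κ)(Re a)² - (1+κ)(Im a)²`. Inserting
  -- `hyy` and `hx` cancels `(Re a)²` and leaves `κ (Im a)² ≤ η²/κ`.
  have hsq : a.im ^ 2 ≤ (η / κ) ^ 2 := by
    have h1 : κ * a.im ^ 2 ≤ η ^ 2 / κ := by
      have e : (1 - τ) * ((-a.re + -κ * a.re) ^ 2 + (0 + (0 - 1 * ((1 + κ) * a.im))) ^ 2)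
          = (1 + κ) * (a.re ^ 2 + a.im ^ 2) := by
        linear_combination (1 + κ) * (a.re ^ 2 + a.im ^ 2) * hκ
      rw [e] at hlevi
      linarith
    have e : (η / κ) ^ 2 = η ^ 2 / κ / κ := by field_simp
    rw [e, le_div_iff₀ hκ0]
    linarith
  have habs : |a.im| ≤ η / κ := abs_le_of_sq_le_sq hsq (by positivity)
  refine (norm_mixedDeriv_signedDist_mul_le hρ hΩ (hfr z rfl) ?_ hf.symm hc0 haf hfy).trans habs
  rw [coeff_apply, hD1, hD1]
  simp

end Annulus

/-! ### The maximum argument and the conclusion -/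

/-- A Diederich–Fornæss exponent satisfies the bound of the theorem. -/
lemma IsDFExponent.le {Ω : Set (Cn 2)} (hH : IsHartogs Ω) {w : ℂ} {A B C τ : ℝ} (hA : 0 < A)
    (hAB : A < B) (hC : 0 < C) (hM : annulus A B w ⊆ frontier Ω)
    (hcurv : ∀ p ∈ annulus A B w, C / ‖p 0‖ < ‖mixedDeriv 1 0 (signedDist Ω) p‖)
    (hτ : IsDFExponent Ω τ) : τ ≤ Real.pi / (2 * C * Real.log (B / A) + Real.pi) := by
  obtain ⟨hτ0, hτ1, ρ, ⟨hρ, hΩ, hne⟩, hpsh⟩ := hτ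
  have hlog : 0 < Real.log (B / A) := Real.log_pos ((one_lt_div hA).mpr hAB)
  have hB : 0 < B := hA.trans hAB
  have hπ := Real.pi_pos
  by_contra! hcon
  rw [div_lt_iff₀ (by positivity)] at hcon
  have h1τ : 0 < 1 - τ := sub_pos.mpr hτ1
  set κ : ℝ := τ / (1 - τ) with hκdef
  have hκ0 : 0 < κ := by positivity
  have hκ : (1 + κ) * (1 - τ) = 1 := by rw [hκdef]; field_simp; ring
  -- Chosen so that `η/κ = 4C`, the value excluded by the curvature hypothesis; the negated bound on
  -- `τ` says exactly that `π/η` is less than the width `log (B/A) / 2` of the annulus in `log |z|`.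
  set η : ℝ := 4 * C * κ with hη
  have hη0 : 0 < η := by positivity
  have hlen : Real.pi < η * (Real.log (B / A) / 2) := by
    have : η * (Real.log (B / A) / 2) = 2 * C * Real.log (B / A) * τ / (1 - τ) := by
      rw [hη, hκdef]; ring
    rw [this, lt_div_iff₀ h1τ]
    linarith
  have hlen' : Real.pi / η < Real.log (B / A) / 2 := by
    rw [div_lt_iff₀ hη0]; linarith
  -- Centres `[x₀, x₀ + π/η]` in the range of `log |z|`, leaving room on both sides, so that `ρ`
  -- vanishes on a neighbourhood in the line of each point used.
  set x₀ : ℝ := Real.log A / 2 + (Real.log (B / A) / 2 - Real.pi / η) / 2 with hx₀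
  -- logarithmic coordinates on the annulus
  have hannulus : ∀ ζ : ℂ, ζ ≠ 0 → x₀ ≤ Real.log ‖ζ‖ → Real.log ‖ζ‖ ≤ x₀ + Real.pi / η →
      A < ‖ζ‖ ^ 2 ∧ ‖ζ‖ ^ 2 < B := by
    intro ζ hζ h1 h2
    have hn : 0 < ‖ζ‖ := norm_pos_iff.mpr hζ
    have e : Real.log (‖ζ‖ ^ 2) = 2 * Real.log ‖ζ‖ := by rw [Real.log_pow]; push_cast; ring
    refine ⟨(Real.log_lt_log_iff hA (by positivity)).mp ?_,
      (Real.log_lt_log_iff (by positivity) hB).mp ?_⟩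
    · rw [e]; linarith
    · rw [Real.log_div hB.ne' hA.ne'] at hlen' hx₀
      rw [e]; linarith
  have hmem : ∀ ζ : ℂ, A ≤ ‖ζ‖ ^ 2 → ‖ζ‖ ^ 2 ≤ B →
      (EuclideanSpace.single 0 ζ + EuclideanSpace.single 1 w : Cn 2) ∈ annulus A B w :=
    fun ζ h1 h2 => by simp [annulus, h1, h2]
  have hfr : ∀ ζ : ℂ, A ≤ ‖ζ‖ ^ 2 → ‖ζ‖ ^ 2 ≤ B →
      (EuclideanSpace.single 0 ζ + EuclideanSpace.single 1 w : Cn 2) ∈ frontier Ω :=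
    fun ζ h1 h2 => hM (hmem ζ h1 h2)
  set f : ℂ → ℂ := fun ζ =>
    coeff 1 (fderiv ℝ ρ (EuclideanSpace.single 0 ζ + EuclideanSpace.single 1 w)) with hf
  have hcont : Continuous f := by
    have h1 : Continuous fun ζ : ℂ =>
        (EuclideanSpace.single 0 ζ + EuclideanSpace.single 1 w : Cn 2) := by
      simp_rw [point_eq]
      fun_prop
    exact (coeff 1).continuous.comp ((contDiff_fderiv_of_contDiff hρ).continuous.comp h1)
  have hzero : ∀ ζ : ℂ, A < ‖ζ‖ ^ 2 → ‖ζ‖ ^ 2 < B →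
      ∀ᶠ ξ in 𝓝 ζ, ρ (EuclideanSpace.single 0 ξ + EuclideanSpace.single 1 w) = 0 := by
    intro ζ h1 h2
    have hc : ContinuousAt (fun ξ : ℂ => ‖ξ‖ ^ 2) ζ := by fun_prop
    filter_upwards [hc.eventually_const_lt h1, hc.eventually_lt_const h2] with ξ k1 k2
    exact eq_zero_of_mem_frontier hρ.continuous (hΩ ▸ hfr ξ k1.le k2.le)
  have hf0 : ∀ ζ : ℂ, A < ‖ζ‖ ^ 2 → ‖ζ‖ ^ 2 < B → f ζ ≠ 0 := by
    intro ζ h1 h2 h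
    refine hne _ (hfr ζ h1.le h2.le) ?_
    ext v
    rw [eq_single_add_single v, map_add, (fderiv_along_line_eq_zero hρ (hzero ζ h1 h2)).1,
      apply_single]
    have h : coeff 1 (fderiv ℝ ρ (EuclideanSpace.single 0 ζ + EuclideanSpace.single 1 w)) = 0 := h
    simp [h]
  set K : Set ℂ := Metric.closedBall 0 (Real.exp (x₀ + Real.pi / η)) ∩ {ζ | Real.exp x₀ ≤ ‖ζ‖}
    with hK
  have hKcomp : IsCompact K :=
    (isCompact_closedBall _ _).inter_right (isClosed_le continuous_const continuous_norm)
  have hKmem : ∀ ζ : ℂ, ζ ∈ K ↔ ζ ≠ 0 ∧ x₀ ≤ Real.log ‖ζ‖ ∧ Real.log ‖ζ‖ ≤ x₀ + Real.pi / η := by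
    intro ζ
    rw [hK, Set.mem_inter_iff, mem_closedBall_zero_iff, Set.mem_ofPred_eq]
    constructor
    · rintro ⟨h1, h2⟩
      have hn : 0 < ‖ζ‖ := (Real.exp_pos _).trans_le h2
      exact ⟨norm_pos_iff.mp hn, (Real.le_log_iff_exp_le hn).mpr h2,
        (Real.log_le_iff_le_exp hn).mpr h1⟩
    · rintro ⟨h0, h1, h2⟩
      have hn : 0 < ‖ζ‖ := norm_pos_iff.mpr h0
      exact ⟨(Real.log_le_iff_le_exp hn).mp h2, (Real.le_log_iff_exp_le hn).mp h1⟩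
  have hKann : ∀ ζ ∈ K, A < ‖ζ‖ ^ 2 ∧ ‖ζ‖ ^ 2 < B := fun ζ hζ => by
    obtain ⟨h0, h1, h2⟩ := (hKmem ζ).mp hζ
    exact hannulus ζ h0 h1 h2
  have hpow : ∀ ζ ∈ K, 0 < ‖f ζ‖ ^ κ := fun ζ hζ =>
    Real.rpow_pos_of_pos (norm_pos_iff.mpr (hf0 ζ (hKann ζ hζ).1 (hKann ζ hζ).2)) _
  set g : ℂ → ℝ := fun ζ => Real.sin (η * (Real.log ‖ζ‖ - x₀)) / ‖f ζ‖ ^ κ with hg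
  have hgcont : ContinuousOn g K := by
    refine ContinuousOn.div ?_ ?_ fun ζ hζ => (hpow ζ hζ).ne'
    · refine Real.continuous_sin.comp_continuousOn (continuousOn_const.mul
        (ContinuousOn.sub (continuous_norm.continuousOn.log fun ζ hζ => ?_) continuousOn_const))
      exact norm_ne_zero_iff.mpr ((hKmem ζ).mp hζ).1
    · exact hcont.norm.continuousOn.rpow_const fun ζ hζ => Or.inr hκ0.le
  have hπη : 0 < Real.pi / η := by positivity
  -- the midpoint of the annulus, where `g` is positive
  set m : ℂ := ((Real.exp (x₀ + Real.pi / η / 2) : ℝ) : ℂ) with hm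
  have hmlog : Real.log ‖m‖ = x₀ + Real.pi / η / 2 := by
    rw [hm, Complex.norm_real, Real.norm_of_nonneg (Real.exp_pos _).le, Real.log_exp]
  have hmK : m ∈ K := by
    rw [hKmem, hmlog]
    refine ⟨by rw [hm]; exact_mod_cast (Real.exp_pos _).ne', by linarith, by linarith⟩
  obtain ⟨z, hzK, hzmax⟩ := hKcomp.exists_isMaxOn ⟨m, hmK⟩ hgcont
  have hgm : 0 < g m := by
    have : η * (Real.log ‖m‖ - x₀) = Real.pi / 2 := by
      rw [hmlog, add_sub_cancel_left]; field_simp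
    simp only [hg, this, Real.sin_pi_div_two]
    exact div_pos one_pos (hpow m hmK)
  obtain ⟨hz0, hz1, hz2⟩ := (hKmem z).mp hzK
  have hzn : 0 < ‖z‖ := norm_pos_iff.mpr hz0
  obtain ⟨hzA, hzB⟩ := hKann z hzK
  set θ := η * (Real.log ‖z‖ - x₀) with hθdef
  have hθ : 0 < Real.sin θ := (div_pos_iff_of_pos_right (hpow z hzK)).mp (hgm.trans_le (hzmax hmK))
  have hcross : ∀ ζ ∈ K, Real.sin (η * (Real.log ‖ζ‖ - x₀)) * ‖f z‖ ^ κ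
      ≤ Real.sin θ * ‖f ζ‖ ^ κ := fun ζ hζ =>
    (div_le_div_iff₀ (hpow ζ hζ) (hpow z hzK)).mp (hzmax hζ)
  have hlt1 : x₀ < Real.log ‖z‖ := by
    refine lt_of_le_of_ne hz1 fun h => ?_
    rw [hθdef, ← h, sub_self, mul_zero, Real.sin_zero] at hθ
    exact lt_irrefl _ hθ
  have hlt2 : Real.log ‖z‖ < x₀ + Real.pi / η := by
    refine lt_of_le_of_ne hz2 fun h => ?_
    have : θ = Real.pi := by rw [hθdef, h, add_sub_cancel_left]; field_simp
    rw [this, Real.sin_pi] at hθ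
    exact lt_irrefl _ hθ
  have hbound := mul_norm_mixedDeriv_le_of_max (w := w) (z := z) (θ := θ) hρ hΩ hH hκ hκ0 hη0 hθ
    (fun q hq v => levi_nonneg_of_isPlurisubharmonicOn hρ hτ0 hΩ hpsh hq v)
    (fun ζ hζ => hfr ζ (by rw [hζ]; exact hzA.le) (by rw [hζ]; exact hzB.le))
    (hzero z hzA hzB) (hf0 z hzA hzB)
    -- The sine is constant on the circle, so maximality there means that `‖f‖` is minimal at `z`.
    (fun ζ hζ => by
      have hζK : ζ ∈ K := by
        rw [hKmem, hζ]
        exact ⟨norm_pos_iff.mp (hζ ▸ hzn), hz1, hz2⟩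
      have := hcross ζ hζK
      rw [hζ] at this
      exact (Real.rpow_le_rpow_iff (norm_nonneg _) (norm_nonneg _) hκ0).mp
        (le_of_mul_le_mul_left this hθ))
    (by
      have hc : ContinuousAt (fun t : ℝ => Real.log ‖z‖ + t) 0 := by fun_prop
      filter_upwards [hc.eventually_const_lt (by simpa using hlt1),
        hc.eventually_lt_const (by simpa using hlt2)] with t h1 h2
      have hl : Real.log ‖z * Complex.exp (t * 1)‖ = Real.log ‖z‖ + t := by
        rw [norm_mul, Complex.norm_exp, Real.log_mul hzn.ne' (Real.exp_pos _).ne', Real.log_exp]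
        simp
      have := hcross (z * Complex.exp (t * 1)) (by
        rw [hKmem, hl]
        exact ⟨mul_ne_zero hz0 (Complex.exp_ne_zero _), h1.le, h2.le⟩)
      rw [hl] at this
      have e : η * (Real.log ‖z‖ + t - x₀) = θ + η * t := by rw [hθdef]; ring
      rwa [e] at this)
  have hlow := hcurv _ (hmem z hzA.le hzB.le)
  have e0 : (EuclideanSpace.single 0 z + EuclideanSpace.single 1 w : Cn 2) 0 = z := by simp
  rw [e0, div_lt_iff₀ hzn] at hlow
  have e1 : η / κ = 4 * C := by rw [hη]; field_simp
  rw [e1] at hbound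
  linarith

end DFIndex

theorem mainTheorem1 (Ω : Set (DFIndex.Cn 2)) (hdom : DFIndex.IsDomainSet Ω)
    (hsmooth : DFIndex.HasSmoothBoundary Ω) (hHartogs : DFIndex.IsHartogs Ω)
    (w : ℂ) (A B C : ℝ) (hA : 0 < A) (hAB : A < B) (hC : 0 < C)
    (hM : DFIndex.annulus A B w ⊆ frontier Ω)
    (hcurv : ∀ p ∈ DFIndex.annulus A B w,
      C / ‖p 0‖ < ‖DFIndex.mixedDeriv 1 0 (DFIndex.signedDist Ω) p‖) :
    DFIndex.dfIndex Ω ≤ Real.pi / (2 * C * Real.log (B / A) + Real.pi) := by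
  have hlog : 0 < Real.log (B / A) := Real.log_pos ((one_lt_div hA).mpr hAB)
  -- The remaining goal, nonnegativity of the bound, covers the case of no exponents, where the
  -- supremum is `0`.
  refine Real.sSup_le (fun τ hτ => hτ.le hHartogs hA hAB hC hM hcurv) ?_
  have := Real.pi_pos
  positivity
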